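/- **Theorem.** Assume $\diamondsuit$: there are sets $A_\alpha\subseteq\alpha$ ($\alpha<\omega_1$) such that for every $X\subseteq\omega_1$ the set $\{\alpha<\omega_1 : X\cap\alpha=A_\alpha\}$ is stationary. Then there is a Countryman line which embeds into all of its uncountable suborders. More precisely, let $\mathbb S$ be the set of all finite-to-one sequences of natural numbers of countable successor length; it is a tree under extension $\subseteq$, a sequence of length $\alpha+1$ having height $\alpha$. Let $\leq_{\mathrm{lex}}$ be the lexicographic order on $\mathbb S$ (initial segments come first). For $s,t\in\mathbb S$ say that $s$ is a $\varrho_2$-modification of $t$ if $|s|=|t|$ and $s-t$ is a continuous integer-valued sequence. A set $T\subseteq\mathbb S$ is $\varrho_2$-coherent if $t\restriction|s|$ is a $\varrho_2$-modification of $s$ whenever $s,t\in T$ and $|s|\le|t|$; it is full if it is uncountable and closed under initial segments of successor length and under $\varrho_2$-modifications. The height of a subset of $\mathbb S$ closed under initial segments of successor length is the least $\delta$ such that it has no element of height $\delta$; a subtree of such a set $T$ is a subset of $T$ which is downward closed in $T$ and has the same height as $T$. For $s\in T$ and $n<\omega$, the frozen cone $T[s,n]$ is the set of all $t\in T$ such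 that $t\subseteq s$, or $s\subseteq t$ and $t(\xi)\ge n$ whenever $|s|\le\xi<|t|$. Then $\diamondsuit$ implies that there are a $\varrho_2$-coherent full subtree $T$ of $\mathbb S$ such that every subtree of $T$ contains a frozen cone $T[s,n]$ with $s\in T$ and $n<\omega$, and an uncountable antichain $C$ of $T$ (a set of pairwise $\subseteq$-incomparable elements) such that the linear order $(C,\leq_{\mathrm{lex}})$ has the following properties. 1. It is Countryman: it has cardinality $\aleph_1$ and its square, ordered coordinatewise, is a union of countably many chains. 2. It embeds into each of its uncountable suborders. 3. It is a minimal Countryman line and a minimal Aronszajn line. Here an Aronszajn line is an uncountable linear order with no uncountable suborder which is separable (in its order topology) or scattered (contains no copy of $\mathbb Q$), and a minimal element of a class of linear orders is a member of the class that embeds into each of its suborders belonging to the class. 4. It is not a Souslin line, i.e. it is not a nonseparable linear order in which every family of pairwise disjoint nonempty open intervals is countable. In particular, $\diamondsuit$ implies that there is a minimal Aronszajn line which is not Souslin, which answers a question of Baumgartner. -/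

import Mathlib

/-! ## Linear orders -/

namespace MinimalCountryman

open Set

universe u

/-- A linear order is scattered if it contains no copy of the rationals. -/
def IsScattered (L : Type u) [LinearOrder L] : Prop :=
  IsEmpty (ℚ ↪o L)

/-- A linear order is separable if it has a countable dense subset in its order topology. -/
def IsSeparableLine (L : Type u) [LinearOrder L] : Prop :=
  @TopologicalSpace.SeparableSpace L (Preorder.topology L)

/-- An Aronszajn line: an uncountable linear order with no uncountable suborder which is
separable or scattered. -/
def IsAronszajnLine (L : Type u) [LinearOrder L] : Prop :=
  Uncountable L ∧
    ∀ X : Set L, ¬ X.Countable → ¬ IsSeparableLine X ∧ ¬ IsScattered X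

/-- A Countryman line: a linear order of cardinality `ℵ₁` whose square, with the coordinatewise
order, is a union of countably many chains. -/
def IsCountrymanLine (L : Type u) [LinearOrder L] : Prop :=
  Cardinal.mk L = Cardinal.aleph 1 ∧
    ∃ F : ℕ → Set (L × L), (∀ n, IsChain (· ≤ ·) (F n)) ∧ ⋃ n, F n = univ

/-- A Souslin line: a nonseparable linear order in which every family of pairwise disjoint
nonempty open intervals is countable. -/
def IsSouslinLine (L : Type u) [LinearOrder L] : Prop :=
  ¬ IsSeparableLine L ∧
    ∀ F : Set (Set L), (∀ I ∈ F, I.Nonempty ∧ ∃ a b, I = Ioo a b) →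
      F.PairwiseDisjoint id → F.Countable

/-- `L` is a minimal element of a class `P` of linear orders if it is in `P` and embeds into each
of its suborders which is in `P`. -/
def IsMinimalIn (P : ∀ (L : Type u) [LinearOrder L], Prop) (L : Type u) [LinearOrder L] : Prop :=
  P L ∧ ∀ X : Set L, P X → Nonempty (L ↪o X)

/-! ## The first uncountable ordinal and Jensen's diamond -/

/-- The ordinal `ω₁`, as a well-ordered type. -/
abbrev Omega1 : Type := (Ordinal.omega.{0} 1).ToType

/-- Jensen's principle `◇`: there is a sequence of sets `A α ⊆ α` for `α < ω₁` such that for every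
`X ⊆ ω₁` the set of `α` with `X ∩ α = A α` is stationary. -/
def Diamond : Prop :=
  ∃ A : Omega1 → Set Omega1, (∀ α, A α ⊆ Iio α) ∧
    ∀ X : Set Omega1, IsStationary {α | X ∩ Iio α = A α}

/-! ## Finite-to-one sequences of countable successor length -/

/-- The set of finite-to-one sequences of natural numbers of countable successor length.
A sequence of length `α + 1` is given by its last index `top = α < ω₁` and its values at the
indices `ξ ≤ α`; it is padded by `0` at the indices beyond `α`, which carry no information. -/
@[ext]
structure 𝕊 where
  top : Omega1
  val : Omega1 → ℕ
  val_eq_zero : ∀ ξ, top < ξ → val ξ = 0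
  finite_fiber : ∀ k, {ξ | ξ ≤ top ∧ val ξ = k}.Finite

namespace 𝕊

/-- The tree order of `𝕊`: `s ⊆ t`, that is, `s` is an initial segment of `t`. -/
def Initial (s t : 𝕊) : Prop :=
  s.top ≤ t.top ∧ ∀ ξ ≤ s.top, s.val ξ = t.val ξ

/-- `t` is an `n`-extension of `s`: it extends `s` and takes only values `≥ n` beyond `s`. -/
def NExtension (n : ℕ) (s t : 𝕊) : Prop :=
  Initial s t ∧ ∀ ξ, s.top < ξ → ξ ≤ t.top → n ≤ t.val ξ

open Classical in
/-- The restriction of `t` to the indices `≤ η` (it is `t` itself if `η` is beyond `t`). -/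
noncomputable def restrict (t : 𝕊) (η : Omega1) : 𝕊 where
  top := min η t.top
  val ξ := if ξ ≤ η then t.val ξ else 0
  val_eq_zero ξ h := by
    split_ifs with h'
    · exact t.val_eq_zero ξ ((min_lt_iff.1 h).resolve_left (not_lt.2 h'))
    · rfl
  finite_fiber k := (t.finite_fiber k).subset <| by
    rintro ξ ⟨h, h'⟩
    rw [le_min_iff] at h
    rw [if_pos h.1] at h'
    exact ⟨h.2, h'⟩

/-- The lexicographic order: `s ≤ t` if `s` is an initial segment of `t`, or else the sequences
differ at a common index and `s` is smaller than `t` at the least such index. -/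
def LexLE (s t : 𝕊) : Prop :=
  Initial s t ∨
    ∃ ξ, ξ ≤ s.top ∧ ξ ≤ t.top ∧ (∀ η < ξ, s.val η = t.val η) ∧ s.val ξ < t.val ξ

theorem LexLE.refl (s : 𝕊) : LexLE s s := Or.inl ⟨le_rfl, fun _ _ => rfl⟩

theorem LexLE.trans {s t u : 𝕊} (h₁ : LexLE s t) (h₂ : LexLE t u) : LexLE s u := by
  rcases h₁ with ⟨a₁, b₁⟩ | ⟨ξ, a₁, b₁, c₁, d₁⟩
  · rcases h₂ with ⟨a₂, b₂⟩ | ⟨ζ, a₂, b₂, c₂, d₂⟩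
    · exact Or.inl ⟨a₁.trans a₂, fun ξ h => (b₁ ξ h).trans (b₂ ξ (h.trans a₁))⟩
    · rcases le_or_gt ζ s.top with h | h
      · exact Or.inr ⟨ζ, h, b₂, fun η hη => (b₁ η (hη.le.trans h)).trans (c₂ η hη),
          by rw [b₁ ζ h]; exact d₂⟩
      · exact Or.inl ⟨h.le.trans b₂, fun η hη => (b₁ η hη).trans (c₂ η (hη.trans_lt h))⟩
  · rcases h₂ with ⟨a₂, b₂⟩ | ⟨ζ, a₂, b₂, c₂, d₂⟩
    · exact Or.inr ⟨ξ, a₁, b₁.trans a₂,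
        fun η hη => (c₁ η hη).trans (b₂ η (hη.le.trans b₁)), by rw [← b₂ ξ b₁]; exact d₁⟩
    · rcases lt_trichotomy ξ ζ with h | rfl | h
      · exact Or.inr ⟨ξ, a₁, h.le.trans b₂,
          fun η hη => (c₁ η hη).trans (c₂ η (hη.trans h)), by rw [← c₂ ξ h]; exact d₁⟩
      · exact Or.inr ⟨ξ, a₁, b₂, fun η hη => (c₁ η hη).trans (c₂ η hη), d₁.trans d₂⟩
      · exact Or.inr ⟨ζ, h.le.trans a₁, b₂,
          fun η hη => (c₁ η (hη.trans h)).trans (c₂ η hη), by rw [c₁ ζ h]; exact d₂⟩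

theorem LexLE.antisymm {s t : 𝕊} (h₁ : LexLE s t) (h₂ : LexLE t s) : s = t := by
  rcases h₁ with ⟨a₁, b₁⟩ | ⟨ξ, a₁, b₁, c₁, d₁⟩
  · rcases h₂ with ⟨a₂, b₂⟩ | ⟨ζ, a₂, b₂, c₂, d₂⟩
    · have h := le_antisymm a₁ a₂
      refine 𝕊.ext h (funext fun ξ => ?_)
      rcases le_or_gt ξ s.top with h' | h'
      · exact b₁ ξ h'
      · rw [s.val_eq_zero ξ h', t.val_eq_zero ξ (h ▸ h')]
    · exact absurd (b₁ ζ b₂) d₂.ne'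
  · rcases h₂ with ⟨a₂, b₂⟩ | ⟨ζ, a₂, b₂, c₂, d₂⟩
    · exact absurd (b₂ ξ b₁) d₁.ne'
    · rcases lt_trichotomy ξ ζ with h | rfl | h
      · exact absurd (c₂ ξ h) d₁.ne'
      · exact absurd (d₁.trans d₂) (lt_irrefl _)
      · exact absurd (c₁ ζ h) d₂.ne'

theorem LexLE.total (s t : 𝕊) : LexLE s t ∨ LexLE t s := by
  by_cases h : ∃ ξ, ξ ≤ min s.top t.top ∧ s.val ξ ≠ t.val ξ
  · obtain ⟨ξ, ⟨hξ, hne⟩, hmin⟩ := WellFounded.has_min (wellFounded_lt (α := Omega1))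
      {ξ | ξ ≤ min s.top t.top ∧ s.val ξ ≠ t.val ξ} h
    have hb : ∀ η < ξ, s.val η = t.val η := fun η hη => by
      by_contra hc
      exact hmin η ⟨hη.le.trans hξ, hc⟩ hη
    rw [le_min_iff] at hξ
    rcases lt_or_gt_of_ne hne with h' | h'
    · exact Or.inl (Or.inr ⟨ξ, hξ.1, hξ.2, hb, h'⟩)
    · exact Or.inr (Or.inr ⟨ξ, hξ.2, hξ.1, fun η hη => (hb η hη).symm, h'⟩)
  · push Not at h
    rcases le_total s.top t.top with h' | h'
    · exact Or.inl (Or.inl ⟨h', fun ξ hξ => h ξ (le_min hξ (hξ.trans h'))⟩)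
    · exact Or.inr (Or.inl ⟨h', fun ξ hξ => (h ξ (le_min (hξ.trans h') hξ)).symm⟩)

open Classical in
/-- `𝕊` and its subsets carry the lexicographic order. -/
noncomputable instance : LinearOrder 𝕊 where
  le := LexLE
  le_refl := LexLE.refl
  le_trans _ _ _ := LexLE.trans
  le_antisymm _ _ := LexLE.antisymm
  le_total := LexLE.total
  toDecidableLE := Classical.decRel _

end 𝕊

/-! ## Modifications, coherence, fullness -/

/-- The restriction of `m` to the indices `≤ α` is a `ϱ₂`-modifier of length `α + 1`: it is
continuous, for the order topology on the indices and the discrete topology on the integers. -/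
def IsModifier (α : Omega1) (m : Omega1 → ℤ) : Prop :=
  @ContinuousOn Omega1 ℤ (Preorder.topology Omega1) inferInstance m (Iic α)

/-- `s` is a `ϱ₂`-modification of `t`: they have the same length and `s - t` is a modifier. -/
def IsModification (s t : 𝕊) : Prop :=
  s.top = t.top ∧ IsModifier s.top fun ξ => (s.val ξ : ℤ) - (t.val ξ : ℤ)

/-- `X ⊆ 𝕊` is `ϱ₂`-coherent: if `s, t ∈ X` and `|s| ≤ |t|`, then `t ↾ |s|` is a `ϱ₂`-modification
of `s`. -/
def IsCoherent (X : Set 𝕊) : Prop :=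
  ∀ s ∈ X, ∀ t ∈ X, s.top ≤ t.top → IsModification (t.restrict s.top) s

/-- `X ⊆ 𝕊` is `ϱ₂`-full: it is uncountable and closed under initial segments of successor length
and under `ϱ₂`-modifications. -/
def IsFull (X : Set 𝕊) : Prop :=
  ¬ X.Countable ∧ (∀ s ∈ X, ∀ t, 𝕊.Initial t s → t ∈ X) ∧
    ∀ s ∈ X, ∀ t, IsModification t s → t ∈ X

/-! ## Subtrees and frozen cones -/

/-- The height of a node of `𝕊`: the order type of its set of proper initial segments of successor
length. A sequence of length `α + 1` has height `α`, and it has the same height in every subset of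
`𝕊` to which it belongs and which is closed under initial segments of successor length. -/
noncomputable def nodeHeight (s : 𝕊) : Ordinal.{0} :=
  Ordinal.typein (α := Omega1) (· < ·) s.top

/-- The height of a subset of `𝕊` closed under initial segments of successor length: the least
ordinal `δ` such that it has no element of height `δ`. -/
noncomputable def treeHeight (X : Set 𝕊) : Ordinal.{0} :=
  sInf {δ | ∀ s ∈ X, nodeHeight s ≠ δ}

/-- `U` is a subtree of `T`: it is a subset of `T`, downward closed in `T`, of the same height. -/
def IsSubtree (U T : Set 𝕊) : Prop :=
  U ⊆ T ∧ (∀ t ∈ U, ∀ s ∈ T, 𝕊.Initial s t → s ∈ U) ∧ treeHeight U = treeHeight T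

/-- The frozen cone `T[s, n]`: the nodes of `T` which are initial segments of `s` or
`n`-extensions of `s`. -/
def frozenCone (T : Set 𝕊) (s : 𝕊) (n : ℕ) : Set 𝕊 :=
  {t ∈ T | 𝕊.Initial t s ∨ 𝕊.NExtension n s t}

end MinimalCountryman

open MinimalCountryman

namespace MinimalCountryman

open Set Filter Topology

/-! ## The first uncountable ordinal -/

/-! A modifier is locally constant on a compact set of ordinals, so it has finitely many
breakpoints. If `n` bounds the values of `s` at these, the modifier at `ξ` depends only on the
number of indices below `ξ` where `s` is at most `n`. A number `n` and a finite list of integers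
therefore code it (`exists_eq_getD_lowCount`). Hence levels of coherent trees are countable. Two
pairs of sequences whose differences have the same code branch at the same index and in the same
direction, so antichains of a coherent tree have squares that are countable unions of chains.

The tree consists of all modifications of sequences `e α`, chosen by recursion. At stage `α` diamond
guesses a set `V` of earlier nodes. If `V` contains no frozen cone, `e α` is built as a limit of
nodes so that none of its modifications is a branch of `V`. Near `α` a modification of `e α` differs
from it by a constant, so countably many tasks (an initial node and an integer shift) suffice
(`exists_top_eq`). A subtree without a frozen cone would be guessed at a level closed under its
witnesses, and could not reach that level.

Given an uncountable `X`, its downward closure contains a frozen cone. The whole antichain is pushed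
into this cone: a countable bottom part is sent to a dense set of nodes of one level, and the rest
is shifted up by `n`. Branching is preserved and passes to extensions in `X` (`exists_strictMono`).
The same cones contain copies of the rationals above every node, which excludes scattered, separable
and Souslin orders. -/

noncomputable instance : TopologicalSpace Omega1 := Preorder.topology Omega1

instance : OrderTopology Omega1 := ⟨rfl⟩

theorem mk_omega1 : Cardinal.mk Omega1 = Cardinal.aleph 1 := by
  rw [Cardinal.mk_toType, Ordinal.card_omega]

theorem typein_lt_omega1 (α : Omega1) :
    Ordinal.typein (α := Omega1) (· < ·) α < Ordinal.omega.{0} 1 := by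
  simpa using Ordinal.typein_lt_type (α := Omega1) (· < ·) α

theorem countable_Iio_omega1 (α : Omega1) : (Iio α).Countable := by
  have h : Ordinal.typein (α := Omega1) (· < ·) α < (Cardinal.aleph 1).ord := by
    rw [Cardinal.ord_aleph]
    exact typein_lt_omega1 α
  rw [Cardinal.lt_ord, Ordinal.card_typein, Cardinal.lt_aleph_one_iff] at h
  exact Cardinal.le_aleph0_iff_set_countable.1 h

theorem countable_Iic_omega1 (α : Omega1) : (Iic α).Countable := by
  rw [← Iio_insert]
  exact (countable_Iio_omega1 α).insert _

theorem not_countable_omega1 : ¬ (univ : Set Omega1).Countable := by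
  rw [← Cardinal.le_aleph0_iff_set_countable, Cardinal.mk_univ, mk_omega1, not_le]
  exact Cardinal.aleph0_lt_aleph_one

theorem exists_forall_lt_of_countable {s : Set Omega1} (hs : s.Countable) :
    ∃ b, ∀ x ∈ s, x < b := by
  by_contra! h
  refine not_countable_omega1 ((hs.biUnion fun x _ => countable_Iic_omega1 x).mono fun b _ => ?_)
  obtain ⟨x, hx, hbx⟩ := h b
  exact mem_biUnion hx hbx

instance : NoMaxOrder Omega1 :=
  ⟨fun a => (exists_forall_lt_of_countable (countable_singleton a)).imp fun _ h => h a rfl⟩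

instance : Nonempty Omega1 :=
  (exists_forall_lt_of_countable countable_empty).nonempty

noncomputable instance : OrderBot Omega1 := WellFoundedLT.toOrderBot _

theorem isOpen_Iic_omega1 (α : Omega1) : IsOpen (Iic α) := by
  rw [← Order.Iio_succ]
  exact isOpen_Iio

theorem nhds_omega1_Iic {α ξ : Omega1} (h : ξ ≤ α) : Iic α ∈ 𝓝 ξ :=
  (isOpen_Iic_omega1 α).mem_nhds h

theorem nhds_omega1_Ioi {α ξ : Omega1} (h : α < ξ) : Ioi α ∈ 𝓝 ξ :=
  isOpen_Ioi.mem_nhds h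

theorem exists_lt_forall_of_eventually_nhds {α : Omega1} (h₀ : ⊥ < α) {p : Omega1 → Prop}
    (h : ∀ᶠ ξ in 𝓝 α, p ξ) : ∃ β < α, ∀ ξ, β < ξ → ξ ≤ α → p ξ := by
  obtain ⟨β, hβ, hp⟩ := exists_Ioc_subset_of_mem_nhds h ⟨⊥, h₀⟩
  exact ⟨β, hβ, fun ξ h₁ h₂ => hp ⟨h₁, h₂⟩⟩

/-- There are arbitrarily large ordinals closed under a given function. -/
theorem exists_gt_forall_lt_imp_lt (f : Omega1 → Omega1) (a : Omega1) :
    ∃ b, a < b ∧ ∀ ξ < b, f ξ < b := by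
  have H : ∀ c : Omega1, ∃ d, c < d ∧ ∀ ξ ≤ c, f ξ < d := fun c => by
    obtain ⟨d, hd⟩ := exists_forall_lt_of_countable
      (((countable_Iic_omega1 c).image f).insert c)
    exact ⟨d, hd _ (mem_insert _ _), fun ξ h => hd _ (mem_insert_of_mem _ ⟨ξ, h, rfl⟩)⟩
  choose g hg hfg using H
  have hne : ({b | ∀ n : ℕ, g^[n] a < b} : Set Omega1).Nonempty := by
    obtain ⟨b, hb⟩ := exists_forall_lt_of_countable (countable_range fun n : ℕ => g^[n] a)
    exact ⟨b, fun n => hb _ ⟨n, rfl⟩⟩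
  obtain ⟨b, hb, hmin⟩ := WellFounded.has_min (wellFounded_lt (α := Omega1)) _ hne
  refine ⟨b, hb 0, fun ξ hξ => ?_⟩
  have h : ∃ n : ℕ, ξ ≤ g^[n] a := by
    by_contra! h
    exact hmin ξ h hξ
  obtain ⟨n, hn⟩ := h
  refine (hfg _ ξ hn).trans ?_
  rw [← Function.iterate_succ_apply' g]
  exact hb (n + 1)

theorem isClub_forall_lt_imp_lt (f : Omega1 → Omega1) :
    IsClub {α : Omega1 | ⊥ < α ∧ ∀ ξ < α, f ξ < α} where
  dirSupClosed d hd hne _ a ha := by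
    obtain ⟨x, hx⟩ := hne
    refine ⟨(hd hx).1.trans_le (ha.1 hx), fun ξ hξ => ?_⟩
    obtain ⟨y, hy, hξy⟩ := (lt_isLUB_iff ha).1 hξ
    exact ((hd hy).2 ξ hξy).trans_le (ha.1 hy)
  isCofinal a := by
    obtain ⟨b, hab, hb⟩ := exists_gt_forall_lt_imp_lt f a
    exact ⟨b, ⟨bot_le.trans_lt hab, hb⟩, hab.le⟩

/-- Diamond for subsets of `ω₁ × ω`. -/
theorem Diamond.exists_guess (h : Diamond) :
    ∃ W : Omega1 → Set (Omega1 × ℕ), ∀ (X : Set (Omega1 × ℕ)) (f : Omega1 → Omega1),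
      ∃ α, ⊥ < α ∧ (∀ ξ < α, f ξ < α) ∧ ∀ β < α, ∀ i, (β, i) ∈ W α ↔ (β, i) ∈ X := by
  obtain ⟨A, -, hA⟩ := h
  have hc : Nonempty (Omega1 × ℕ ↪ Omega1) := by
    rw [← Cardinal.le_def, Cardinal.mk_prod, mk_omega1]
    simp
  obtain ⟨c⟩ := hc
  have hg : ∀ β, ∃ γ, ∀ i, c (β, i) < γ := fun β => by
    obtain ⟨γ, hγ⟩ := exists_forall_lt_of_countable (countable_range fun i : ℕ => c (β, i))
    exact ⟨γ, fun i => hγ _ ⟨i, rfl⟩⟩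
  choose g hg using hg
  refine ⟨fun α => c ⁻¹' A α, fun X f => ?_⟩
  -- Closure under `g` puts the codes of all pairs over ordinals below `α` below `α`, so the guess
  -- decides them.
  obtain ⟨α, hα, h₀, hcl⟩ := hA (c '' X) (isClub_forall_lt_imp_lt fun ξ => max (f ξ) (g ξ))
  refine ⟨α, h₀, fun ξ h => (le_max_left _ _).trans_lt (hcl ξ h), fun β hβ i => ?_⟩
  have hlt : c (β, i) < α := (hg β i).trans ((le_max_right _ _).trans_lt (hcl β hβ))
  rw [mem_preimage, ← show c '' X ∩ Iio α = A α from hα]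
  simp [hlt]

/-! ## Modifiers -/

theorem isModifier_iff {α : Omega1} {m : Omega1 → ℤ} :
    IsModifier α m ↔ ∀ ξ ≤ α, ∀ᶠ η in 𝓝 ξ, m η = m ξ := by
  refine forall₂_congr fun ξ hξ => ?_
  change Tendsto m (𝓝[Iic α] ξ) (𝓝 (m ξ)) ↔ _
  rw [nhdsWithin_eq_nhds.2 (nhds_omega1_Iic hξ), nhds_discrete ℤ, tendsto_pure]

namespace IsModifier

variable {α β : Omega1} {m m' : Omega1 → ℤ}

theorem mono (h : IsModifier α m) (hβ : β ≤ α) : IsModifier β m :=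
  ContinuousOn.mono h (Iic_subset_Iic.2 hβ)

theorem congr (h : IsModifier α m) (hm : ∀ ξ ≤ α, m' ξ = m ξ) : IsModifier α m' :=
  ContinuousOn.congr h hm

theorem add (h : IsModifier α m) (h' : IsModifier α m') :
    IsModifier α fun ξ => m ξ + m' ξ :=
  ContinuousOn.add h h'

theorem neg (h : IsModifier α m) : IsModifier α fun ξ => -m ξ :=
  ContinuousOn.neg h

theorem const (α : Omega1) (k : ℤ) : IsModifier α fun _ => k :=
  continuousOn_const

/-- A modifier of length `β + 1` may be continued by a constant. -/
theorem splice {k : ℤ} (h : IsModifier β m) (hm : ∀ ξ ≤ β, m' ξ = m ξ)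
    (hk : ∀ ξ, β < ξ → ξ ≤ α → m' ξ = k) : IsModifier α m' := by
  rw [isModifier_iff] at h ⊢
  intro ξ hξ
  rcases le_or_gt ξ β with hβ | hβ
  · filter_upwards [h ξ hβ, nhds_omega1_Iic hβ] with η h₁ h₂
    rw [hm ξ hβ, hm η h₂, h₁]
  · filter_upwards [nhds_omega1_Ioi hβ, nhds_omega1_Iic hξ] with η h₁ h₂
    rw [hk ξ hβ hξ, hk η h₁ h₂]

/-- Continuity at `α` makes `m` constant on some `(β, α]`; induction handles the indices up to `β`,
and `β` is added as a breakpoint. The last hypothesis says that no breakpoint lies in `[ξ, η)`. -/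
theorem exists_finset (h : IsModifier α m) :
    ∃ B : Finset Omega1, (∀ b ∈ B, b ≤ α) ∧ ∀ ξ η, ξ ≤ η → η ≤ α →
      (∀ b ∈ B, b < η → b < ξ) → m ξ = m η := by
  classical
  induction α using WellFoundedLT.induction with
  | ind α ih =>
    rcases (bot_le (a := α)).eq_or_lt with rfl | h₀
    · refine ⟨∅, by simp, fun ξ η h₁ h₂ _ => ?_⟩
      rw [le_bot_iff.1 h₂, le_bot_iff.1 (h₁.trans h₂)]
    · obtain ⟨β, hβ, hm⟩ :=
        exists_lt_forall_of_eventually_nhds h₀ (isModifier_iff.1 h α le_rfl)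
      obtain ⟨B, hB, hmB⟩ := ih β hβ (h.mono hβ.le)
      refine ⟨insert β B, ?_, fun ξ η h₁ h₂ h₃ => ?_⟩
      · simpa [hβ.le] using fun b hb => (hB b hb).trans hβ.le
      · rcases le_or_gt η β with h' | h'
        · exact hmB ξ η h₁ h' fun b hb => h₃ b (Finset.mem_insert_of_mem hb)
        · rw [hm η h' h₂, hm ξ (h₃ β (Finset.mem_insert_self _ _) h') (h₁.trans h₂)]

end IsModifier

/-! ## Sequences -/

namespace 𝕊

variable {s t u : 𝕊}

theorem Initial.refl (s : 𝕊) : Initial s s := ⟨le_rfl, fun _ _ => rfl⟩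

theorem Initial.trans (h : Initial s t) (h' : Initial t u) : Initial s u :=
  ⟨h.1.trans h'.1, fun ξ hξ => (h.2 ξ hξ).trans (h'.2 ξ (hξ.trans h.1))⟩

theorem ext_of_le (h : s.top = t.top) (h' : ∀ ξ ≤ s.top, s.val ξ = t.val ξ) : s = t := by
  refine 𝕊.ext h (funext fun ξ => ?_)
  rcases le_or_gt ξ s.top with hξ | hξ
  · exact h' ξ hξ
  · rw [s.val_eq_zero ξ hξ, t.val_eq_zero ξ (h ▸ hξ)]

theorem Initial.eq_of_top_le (h : Initial s t) (h' : t.top ≤ s.top) : s = t :=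
  ext_of_le (le_antisymm h.1 h') h.2

theorem Initial.of_le (h : Initial s u) (h' : Initial t u) (hst : s.top ≤ t.top) :
    Initial s t :=
  ⟨hst, fun ξ hξ => (h.2 ξ hξ).trans (h'.2 ξ (hξ.trans hst)).symm⟩

theorem Initial.total (h : Initial s u) (h' : Initial t u) : Initial s t ∨ Initial t s :=
  (le_total s.top t.top).imp (fun hst => h.of_le h' hst) fun hts => h'.of_le h hts

@[simp]
theorem restrict_top (t : 𝕊) (η : Omega1) : (t.restrict η).top = min η t.top := rfl

theorem restrict_val {η ξ : Omega1} (h : ξ ≤ η) : (t.restrict η).val ξ = t.val ξ := if_pos h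

theorem restrict_initial (t : 𝕊) (η : Omega1) : Initial (t.restrict η) t :=
  ⟨min_le_right _ _, fun _ h => restrict_val (h.trans (min_le_left _ _))⟩

theorem Initial.eq_restrict (h : Initial s t) : s = t.restrict s.top :=
  ext_of_le (min_eq_left h.1).symm fun ξ hξ => (h.2 ξ hξ).trans (restrict_val hξ).symm

theorem restrict_top_self (t : 𝕊) : t.restrict t.top = t := (Initial.refl t).eq_restrict.symm

theorem restrict_eq_self {η : Omega1} (h : t.top ≤ η) : t.restrict η = t :=
  (restrict_initial t η).eq_of_top_le (le_min h le_rfl)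

theorem Initial.restrict_eq {η : Omega1} (h : Initial s t) (hη : η ≤ s.top) :
    t.restrict η = s.restrict η :=
  ext_of_le (by simp [hη, hη.trans h.1]) fun ξ hξ => by
    have hξ' : ξ ≤ η := hξ.trans (min_le_left _ _)
    rw [restrict_val hξ', restrict_val hξ', h.2 ξ (hξ'.trans hη)]

theorem NExtension.trans {n : ℕ} (h : NExtension n s t) (h' : NExtension n t u) :
    NExtension n s u := by
  refine ⟨h.1.trans h'.1, fun ξ h₁ h₂ => ?_⟩
  rcases le_or_gt ξ t.top with hξ | hξ
  · rw [← h'.1.2 ξ hξ]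
    exact h.2 ξ h₁ hξ
  · exact h'.2 ξ hξ h₂

theorem NExtension.mono {n k : ℕ} (h : NExtension n s t) (hk : k ≤ n) : NExtension k s t :=
  ⟨h.1, fun ξ h₁ h₂ => hk.trans (h.2 ξ h₁ h₂)⟩

theorem NExtension.refl (n : ℕ) (s : 𝕊) : NExtension n s s :=
  ⟨.refl s, fun _ h₁ h₂ => absurd h₁ h₂.not_gt⟩

theorem finite_val_le (s : 𝕊) (n : ℕ) : {ξ | ξ ≤ s.top ∧ s.val ξ ≤ n}.Finite := by
  refine ((finite_Iic n).biUnion fun k _ => s.finite_fiber k).subset ?_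
  rintro ξ ⟨h₁, h₂⟩
  exact mem_biUnion (mem_Iic.2 h₂) ⟨h₁, rfl⟩

/-- The indices at which `s` takes a value `≤ n`. -/
noncomputable def low (s : 𝕊) (n : ℕ) : Finset Omega1 := (s.finite_val_le n).toFinset

theorem mem_low {n : ℕ} {ξ : Omega1} : ξ ∈ s.low n ↔ ξ ≤ s.top ∧ s.val ξ ≤ n := by
  simp [low]

open Classical in
/-- The number of indices below `ξ` at which `s` takes a value `≤ n`. -/
noncomputable def lowCount (s : 𝕊) (n : ℕ) (ξ : Omega1) : ℕ := ((s.low n).filter (· < ξ)).card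

theorem lowCount_congr {n : ℕ} {ξ : Omega1} (hs : ξ ≤ s.top) (ht : ξ ≤ t.top)
    (h : ∀ η < ξ, s.val η = t.val η) : s.lowCount n ξ = t.lowCount n ξ := by
  classical
  unfold lowCount
  congr 1
  ext η
  simp only [Finset.mem_filter, mem_low]
  constructor
  · rintro ⟨⟨-, h₁⟩, h₂⟩
    exact ⟨⟨h₂.le.trans ht, h η h₂ ▸ h₁⟩, h₂⟩
  · rintro ⟨⟨-, h₁⟩, h₂⟩
    exact ⟨⟨h₂.le.trans hs, (h η h₂).symm ▸ h₁⟩, h₂⟩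

/-- With `n` bounding `s` on the breakpoints, indices with equal `lowCount` have no breakpoint
between them. Since `lowCount` at `ξ` looks only below `ξ`, the code predicts the difference at a
branching index from the common part. -/
theorem exists_eq_getD_lowCount {m : Omega1 → ℤ} (h : IsModifier s.top m) :
    ∃ (n : ℕ) (g : List ℤ), ∀ ξ ≤ s.top, m ξ = g.getD (s.lowCount n ξ) 0 := by
  classical
  obtain ⟨B, hB, hm⟩ := h.exists_finset
  obtain ⟨n, hn⟩ : ∃ n, ∀ b ∈ B, s.val b ≤ n :=
    ⟨B.sup s.val, fun b hb => Finset.le_sup (f := s.val) hb⟩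
  have key : ∀ ξ η, ξ ≤ η → η ≤ s.top → s.lowCount n ξ = s.lowCount n η → m ξ = m η := by
    intro ξ η h₁ h₂ h₃
    refine hm ξ η h₁ h₂ fun b hb hbη => ?_
    have hsub : (s.low n).filter (· < ξ) ⊆ (s.low n).filter (· < η) := fun x hx => by
      rw [Finset.mem_filter] at hx ⊢
      exact ⟨hx.1, hx.2.trans_le h₁⟩
    have heq := Finset.eq_of_subset_of_card_le hsub h₃.ge
    have hb' : b ∈ (s.low n).filter (· < η) :=
      Finset.mem_filter.2 ⟨mem_low.2 ⟨hB b hb, hn b hb⟩, hbη⟩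
    rw [← heq] at hb'
    exact (Finset.mem_filter.1 hb').2
  let G : ℕ → ℤ := fun j =>
    if h : ∃ ξ, ξ ≤ s.top ∧ s.lowCount n ξ = j then m h.choose else 0
  have hG : ∀ ξ ≤ s.top, m ξ = G (s.lowCount n ξ) := fun ξ hξ => by
    have hex : ∃ η, η ≤ s.top ∧ s.lowCount n η = s.lowCount n ξ := ⟨ξ, hξ, rfl⟩
    have hc := hex.choose_spec
    simp only [G, dif_pos hex]
    rcases le_total ξ hex.choose with h' | h'
    · exact key _ _ h' hc.1 hc.2.symm
    · exact (key _ _ h' hξ hc.2).symm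
  refine ⟨n, (List.range ((s.low n).card + 1)).map G, fun ξ hξ => ?_⟩
  have hlt : s.lowCount n ξ < (s.low n).card + 1 :=
    Nat.lt_succ_of_le (Finset.card_filter_le _ _)
  rw [hG ξ hξ, List.getD_eq_getElem _ _ (by simpa using hlt)]
  simp

open Classical in
/-- The sequence `s`, continued by the values of `u + k`. -/
noncomputable def splice (s u : 𝕊) (k : ℤ) : 𝕊 where
  top := max s.top u.top
  val ξ := if ξ ≤ s.top then s.val ξ else if ξ ≤ u.top then (u.val ξ + k).toNat else 0
  val_eq_zero ξ h := by
    rw [max_lt_iff] at h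
    rw [if_neg h.1.not_ge, if_neg h.2.not_ge]
  finite_fiber j := by
    -- A value `j` after shifting by `k`, even if truncated, comes from a value at most `j + |k|`.
    refine ((s.finite_fiber j).union (u.finite_val_le (j + k.natAbs))).subset ?_
    rintro ξ ⟨h₁, h₂⟩
    split_ifs at h₂ with h₃ h₄
    · exact Or.inl ⟨h₃, h₂⟩
    · exact Or.inr ⟨h₄, by omega⟩
    · exact absurd h₁ (by simp [not_le.1 h₃, not_le.1 h₄])

theorem splice_top {k : ℤ} (h : s.top ≤ u.top) : (splice s u k).top = u.top := max_eq_right h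

theorem splice_val {k : ℤ} {ξ : Omega1} (h : ξ ≤ s.top) : (splice s u k).val ξ = s.val ξ :=
  if_pos h

theorem splice_val_of_gt {k : ℤ} {ξ : Omega1} (h : s.top < ξ) (h' : ξ ≤ u.top) :
    (splice s u k).val ξ = (u.val ξ + k).toNat := by
  simp [splice, h.not_ge, h']

theorem initial_splice {k : ℤ} : Initial s (splice s u k) :=
  ⟨le_max_left _ _, fun _ h => (splice_val h).symm⟩

end 𝕊

open 𝕊

/-! ## Modifications -/

namespace IsModification

variable {s t u : 𝕊}

theorem refl (s : 𝕊) : IsModification s s :=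
  ⟨rfl, (IsModifier.const _ 0).congr fun ξ _ => by simp⟩

theorem symm (h : IsModification s t) : IsModification t s :=
  ⟨h.1.symm, h.1 ▸ h.2.neg.congr fun ξ _ => by ring⟩

theorem trans (h : IsModification s t) (h' : IsModification t u) : IsModification s u :=
  ⟨h.1.trans h'.1, (h.2.add (h.1 ▸ h'.2)).congr fun ξ _ => by ring⟩

theorem restrict (h : IsModification s t) (η : Omega1) :
    IsModification (s.restrict η) (t.restrict η) := by
  refine ⟨by simp [h.1], (h.2.mono (restrict_initial s η).1).congr fun ξ hξ => ?_⟩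
  have hξ' : ξ ≤ η := hξ.trans (min_le_left _ _)
  rw [restrict_val hξ', restrict_val hξ']

/-- The difference is continuous on a clopen initial segment and equals `k` after it; `hk` ensures
that `toNat` truncates nothing. -/
theorem splice {k : ℤ} (hsu : s.top ≤ u.top) (h : IsModification s (u.restrict s.top))
    (hk : ∀ ξ, s.top < ξ → ξ ≤ u.top → 0 ≤ u.val ξ + k) :
    IsModification (splice s u k) u := by
  refine ⟨splice_top hsu, h.2.splice (k := k) (fun ξ hξ => ?_) fun ξ h₁ h₂ => ?_⟩
  · rw [splice_val hξ, restrict_val hξ]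
  · rw [splice_top hsu] at h₂
    rw [splice_val_of_gt h₁ h₂, Int.toNat_of_nonneg (hk ξ h₁ h₂)]
    ring

end IsModification

theorem countable_setOf_isModification (s : 𝕊) : {t | IsModification t s}.Countable := by
  have hsub : {t | IsModification t s} ⊆ ⋃ p : ℕ × List ℤ, {t | t.top = s.top ∧
      ∀ ξ ≤ s.top, (t.val ξ : ℤ) - s.val ξ = p.2.getD (s.lowCount p.1 ξ) 0} := by
    intro t ht
    obtain ⟨n, g, h⟩ := exists_eq_getD_lowCount (ht.1 ▸ ht.2)
    exact mem_iUnion.2 ⟨(n, g), ht.1, h⟩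
  refine (countable_iUnion fun p => Set.Subsingleton.countable ?_).mono hsub
  rintro t ⟨ht, ht'⟩ u ⟨hu, hu'⟩
  refine ext_of_le (ht.trans hu.symm) fun ξ hξ => ?_
  have h₁ := ht' ξ (hξ.trans ht.le)
  have h₂ := hu' ξ (hξ.trans ht.le)
  omega

/-! ## Coherent sets closed under initial segments and modifications -/

/-- A `ϱ₂`-coherent set closed under initial segments and modifications. -/
structure IsCoherentTree (S : Set 𝕊) : Prop where
  initial : ∀ s ∈ S, ∀ t, Initial t s → t ∈ S
  modification : ∀ s ∈ S, ∀ t, IsModification t s → t ∈ S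
  coherent : IsCoherent S

namespace IsCoherentTree

variable {S : Set 𝕊} {s t u : 𝕊}

theorem restrict_mem (hS : IsCoherentTree S) (hs : s ∈ S) (η : Omega1) : s.restrict η ∈ S :=
  hS.initial s hs _ (restrict_initial s η)

theorem isModification (hS : IsCoherentTree S) (hs : s ∈ S) (ht : t ∈ S)
    (h : s.top = t.top) : IsModification s t := by
  have := hS.coherent t ht s hs h.ge
  rwa [restrict_eq_self h.le] at this

/-- The cut-and-paste operation behind all later constructions: a lower part may be replaced and the
upper part shifted without leaving the tree. -/
theorem splice_mem (hS : IsCoherentTree S) (hs : s ∈ S) (hu : u ∈ S) (hsu : s.top ≤ u.top)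
    {k : ℤ} (hk : ∀ ξ, s.top < ξ → ξ ≤ u.top → 0 ≤ u.val ξ + k) : splice s u k ∈ S :=
  hS.modification u hu _ (.splice hsu (hS.coherent s hs u hu hsu).symm hk)

/-- In a coherent tree, every node has an `n`-extension at every height where there is a node. -/
theorem exists_nExtension (hS : IsCoherentTree S) (hs : s ∈ S) (hu : u ∈ S)
    (hsu : s.top ≤ u.top) (n : ℕ) : ∃ t ∈ S, t.top = u.top ∧ NExtension n s t := by
  refine ⟨splice s u n, hS.splice_mem hs hu hsu fun _ _ _ => by positivity, splice_top hsu,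
    initial_splice, fun ξ h₁ h₂ => ?_⟩
  rw [splice_top hsu] at h₂
  rw [splice_val_of_gt h₁ h₂]
  omega

theorem countable_level (hS : IsCoherentTree S) (α : Omega1) :
    {t ∈ S | t.top = α}.Countable := by
  rcases eq_empty_or_nonempty {t ∈ S | t.top = α} with h | ⟨s, hs, hsα⟩
  · simp [h]
  · exact (countable_setOf_isModification s).mono fun t ht =>
      hS.isModification ht.1 hs (ht.2.trans hsα.symm)

theorem countable_top_le (hS : IsCoherentTree S) (α : Omega1) :
    {t ∈ S | t.top ≤ α}.Countable := by
  refine ((countable_Iic_omega1 α).biUnion fun β _ => hS.countable_level β).mono ?_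
  rintro t ⟨ht, hα⟩
  exact mem_biUnion (mem_Iic.2 hα) ⟨ht, rfl⟩

theorem countable_top_lt (hS : IsCoherentTree S) (α : Omega1) :
    {t ∈ S | t.top < α}.Countable := by
  refine (hS.countable_top_le α).mono ?_
  rintro t ⟨ht, hα⟩
  exact ⟨ht, hα.le⟩

end IsCoherentTree

/-! ### Limit levels avoiding a given set -/

namespace IsCoherentTree

variable {S : Set 𝕊} {s t u : 𝕊}

/-- If `V` contains no frozen cone of `S`, then every node `t` has an `n`-extension `t'` such that
every sequence which extends `σ`, and whose values after that are those of `t'` shifted by `k`, has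
an initial segment outside `V`. -/
theorem exists_nExtension_restrict_notMem (hS : IsCoherentTree S) {V : Set 𝕊}
    (hV : ∀ s ∈ S, ∀ n, ∃ u ∈ S, (Initial u s ∨ NExtension n s u) ∧ u ∉ V)
    {σ : 𝕊} (ht : t ∈ S) (hσ : σ ∈ S) (n : ℕ) (k : ℤ) :
    ∃ t' ∈ S, NExtension n t t' ∧ σ.top ≤ t'.top ∧
      ∀ v, Initial σ v → t'.top ≤ v.top →
        (∀ ξ, σ.top < ξ → ξ ≤ t'.top → (v.val ξ : ℤ) = t'.val ξ + k) →
        ∃ β ≤ t'.top, v.restrict β ∉ V := by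
  obtain ⟨t₁, ht₁, htt₁, hσt₁⟩ : ∃ t₁ ∈ S, NExtension n t t₁ ∧ σ.top ≤ t₁.top := by
    rcases le_total t.top σ.top with h | h
    · obtain ⟨t₁, h₁, h₂, h₃⟩ := hS.exists_nExtension ht hσ h n
      exact ⟨t₁, h₁, h₃, h₂.ge⟩
    · exact ⟨t, ht, .refl n t, h⟩
  by_cases hk : ∀ ξ, σ.top < ξ → ξ ≤ t₁.top → 0 ≤ (t₁.val ξ : ℤ) + k
  · have hs := hS.splice_mem hσ ht₁ hσt₁ hk
    have htσ := splice_top (k := k) hσt₁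
    have hv : ∀ v, Initial σ v → t₁.top ≤ v.top →
        (∀ ξ, σ.top < ξ → ξ ≤ t₁.top → (v.val ξ : ℤ) = t₁.val ξ + k) →
        Initial (splice σ t₁ k) v := by
      intro v h₁ h₂ h₃
      refine ⟨htσ.trans_le h₂, fun ξ hξ => ?_⟩
      rw [htσ] at hξ
      rcases le_or_gt ξ σ.top with h | h
      · rw [splice_val h, h₁.2 ξ h]
      · rw [splice_val_of_gt h hξ, ← h₃ ξ h hξ, Int.toNat_natCast]
    -- The summand `k.natAbs` keeps the values of `u` at least `n` after they are shifted back by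
    -- `-k`.
    obtain ⟨u, hu, h | h, huV⟩ := hV _ hs (n + k.natAbs)
    · refine ⟨t₁, ht₁, htt₁, hσt₁, fun v h₁ h₂ h₃ => ⟨u.top, h.1.trans htσ.le, ?_⟩⟩
      rwa [← (h.trans (hv v h₁ h₂ h₃)).eq_restrict]
    · have htu : t₁.top ≤ u.top := htσ.ge.trans h.1.1
      have hu' : ∀ ξ, t₁.top < ξ → ξ ≤ u.top → n + k.natAbs ≤ u.val ξ := fun ξ h₁ h₂ =>
        h.2 ξ (htσ.trans_lt h₁) h₂
      have htop := splice_top (k := -k) htu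
      refine ⟨splice t₁ u (-k), hS.splice_mem ht₁ hu htu fun ξ h₁ h₂ => ?_,
        htt₁.trans ⟨initial_splice, fun ξ h₁ h₂ => ?_⟩, ?_,
        fun v h₁ h₂ h₃ => ⟨u.top, htop.ge, ?_⟩⟩
      · have := hu' ξ h₁ h₂
        omega
      · rw [htop] at h₂
        rw [splice_val_of_gt h₁ h₂]
        have := hu' ξ h₁ h₂
        omega
      · exact htop ▸ hσt₁.trans htu
      · rw [htop] at h₂ h₃
        have hsv := hv v h₁ (htu.trans h₂) fun ξ h₄ h₅ => by
          rw [h₃ ξ h₄ (h₅.trans htu), splice_val h₅]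
        have huv : Initial u v := by
          refine ⟨h₂, fun ξ hξ => ?_⟩
          rcases le_or_gt ξ t₁.top with h' | h'
          · rw [← h.1.2 ξ (h'.trans htσ.ge), hsv.2 ξ (h'.trans htσ.ge)]
          · have h₄ := h₃ ξ (hσt₁.trans_lt h') hξ
            rw [splice_val_of_gt h' hξ] at h₄
            have := hu' ξ h' hξ
            omega
        rwa [← huv.eq_restrict]
  -- If some shifted value is negative, no sequence `v` satisfies the requirement.
  · push Not at hk
    obtain ⟨ξ, h₁, h₂, h₃⟩ := hk
    refine ⟨t₁, ht₁, htt₁, hσt₁, fun v _ _ h => ?_⟩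
    have := h ξ h₁ h₂
    omega

/-- The union of a sequence of nodes, each an `n`-extension of the preceding one. -/
theorem exists_initial_of_nExtension {α : Omega1} (t : ℕ → 𝕊)
    (ht : ∀ n, NExtension n (t n) (t (n + 1))) (hα : ∀ n, (t n).top < α)
    (hcof : ∀ ξ < α, ∃ n, ξ ≤ (t n).top) :
    ∃ s : 𝕊, s.top = α ∧ ∀ n, Initial (t n) s := by
  classical
  have hmono : ∀ n k, n ≤ k → NExtension n (t n) (t k) := fun n k h => by
    induction k, h using Nat.le_induction with
    | base => exact .refl n _
    | succ k hk ih => exact ih.trans ((ht k).mono hk)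
  have hinit : ∀ m n ξ, ξ ≤ (t m).top → ξ ≤ (t n).top → (t m).val ξ = (t n).val ξ := by
    intro m n ξ hm hn
    rcases le_total m n with h | h
    · exact (hmono m n h).1.2 ξ hm
    · exact ((hmono n m h).1.2 ξ hn).symm
  -- The default gives the limit sequence the value `0` at its last index `α`.
  let f : Omega1 → ℕ := fun ξ => if h : ∃ n, ξ ≤ (t n).top then (t h.choose).val ξ else 0
  have hf : ∀ n ξ, ξ ≤ (t n).top → f ξ = (t n).val ξ := fun n ξ h => by
    have hex : ∃ n, ξ ≤ (t n).top := ⟨n, h⟩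
    simp only [f, dif_pos hex]
    exact hinit _ _ ξ hex.choose_spec h
  refine ⟨⟨α, f, fun ξ hξ => ?_, fun k => ?_⟩, rfl, fun n => ⟨(hα n).le, fun ξ h => ?_⟩⟩
  · refine dif_neg ?_
    rintro ⟨n, hn⟩
    exact (hξ.trans_le hn).not_gt (hα n)
  -- Beyond `t (k + 1)` and below `α` all values are at least `k + 1`, so the value `k` no longer
  -- occurs there.
  · refine (((t (k + 1)).finite_fiber k).insert α).subset ?_
    rintro ξ ⟨h₁, h₂⟩
    rcases h₁.eq_or_lt with rfl | h₁
    · exact mem_insert _ _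
    · refine mem_insert_of_mem _ ?_
      by_contra hc
      have hlt : (t (k + 1)).top < ξ := by
        by_contra! h
        exact hc ⟨h, (hf _ ξ h).symm.trans h₂⟩
      obtain ⟨n, hn⟩ := hcof ξ h₁
      have hkn : k + 1 ≤ n := by
        by_contra! h
        exact (hn.trans (hmono n (k + 1) h.le).1.1).not_gt hlt
      have := (hmono _ n hkn).2 ξ hlt hn
      rw [← hf n ξ hn, h₂] at this
      omega
  · exact (hf n ξ h).symm

/-- A coherent tree of height `α` may be continued by a level such that no node of this level
is a branch of a set `V` which contains no frozen cone. -/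
theorem exists_top_eq (hS : IsCoherentTree S) {α : Omega1} (h₀ : ⊥ < α)
    (htop : ∀ s ∈ S, s.top < α) (hex : ∀ β < α, ∃ s ∈ S, s.top = β) {V : Set 𝕊}
    (hV : ∀ s ∈ S, ∀ n, ∃ u ∈ S, (Initial u s ∨ NExtension n s u) ∧ u ∉ V) :
    ∃ s, s.top = α ∧ (∀ β < α, s.restrict β ∈ S) ∧
      ∀ t, IsModification t s → ∃ β < α, t.restrict β ∉ V := by
  have hc : S.Countable := by
    refine (hS.countable_top_lt α).mono ?_
    exact fun t ht => ⟨ht, htop t ht⟩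
  obtain ⟨s₀, hs₀, -⟩ := hex ⊥ h₀
  have := hc.to_subtype
  have : Nonempty S := ⟨⟨s₀, hs₀⟩⟩
  -- The tasks `(σ, k)`: to defeat the branches that start with `σ` and then follow `s` shifted by
  -- `k`.
  obtain ⟨r, hr⟩ := exists_surjective_nat (S × ℤ)
  have step := fun (t : S) (n : ℕ) =>
    hS.exists_nExtension_restrict_notMem hV t.2 (r n).1.2 n (r n).2
  choose g hgS hgt hgr hgV using step
  let t : ℕ → S := fun n => n.rec ⟨s₀, hs₀⟩ fun k x => ⟨g x k, hgS x k⟩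
  have hcof : ∀ ξ < α, ∃ n, ξ ≤ (t n).1.top := fun ξ hξ => by
    obtain ⟨σ, hσ, rfl⟩ := hex ξ hξ
    obtain ⟨n, hn⟩ := hr (⟨σ, hσ⟩, 0)
    refine ⟨n + 1, ?_⟩
    have := hgr (t n) n
    rwa [hn] at this
  obtain ⟨s, hs, hts⟩ := exists_initial_of_nExtension (fun n => (t n).1) (fun n => hgt (t n) n)
    (fun n => htop _ (t n).2) hcof
  have hres : ∀ β < α, s.restrict β ∈ S := fun β hβ => by
    obtain ⟨n, hn⟩ := hcof β hβ
    rw [(hts n).restrict_eq hn]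
    exact hS.restrict_mem (t n).2 β
  refine ⟨s, hs, hres, fun v hv => ?_⟩
  have hvα : v.top = α := hv.1.trans hs
  -- Continuity at `α` makes `v - s` constant after some `β`, so `v` belongs to the task given by
  -- `v.restrict β` and this constant.
  obtain ⟨β, hβ, hβv⟩ := exists_lt_forall_of_eventually_nhds h₀
    (isModifier_iff.1 hv.2 α hvα.ge)
  obtain ⟨n, hn⟩ := hr (⟨v.restrict β, hS.modification _ (hres β hβ) _ (hv.restrict β)⟩,
    (v.val α : ℤ) - s.val α)
  have hlt : (t (n + 1)).1.top < α := htop _ (t (n + 1)).2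
  have key := hgV (t n) n v
  rw [hn] at key
  obtain ⟨γ, hγ, hγV⟩ := key (restrict_initial v β) (hlt.le.trans hvα.ge) fun ξ h₁ h₂ => by
    have h₁' : β < ξ := by simpa [hβ.le.trans hvα.ge] using h₁
    have h₃ := hβv ξ h₁' (h₂.trans hlt.le)
    have h₄ : (g (t n) n).val ξ = s.val ξ := (hts (n + 1)).2 ξ h₂
    rw [h₄]
    dsimp only at h₃ ⊢
    omega
  exact ⟨γ, hγ.trans_lt hlt, hγV⟩

end IsCoherentTree

/-! ## Heights -/

theorem treeHeight_eq_omega1_iff {X : Set 𝕊} :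
    treeHeight X = Ordinal.omega 1 ↔ ∀ α, ∃ s ∈ X, s.top = α := by
  constructor
  · intro h α
    by_contra! hα
    have : Ordinal.typein (α := Omega1) (· < ·) α ∈ {δ | ∀ s ∈ X, nodeHeight s ≠ δ} :=
      fun s hs h => hα s hs (Ordinal.typein_injective _ h)
    exact ((csInf_le' this).trans_lt (typein_lt_omega1 α)).ne h
  · intro h
    refine le_antisymm (csInf_le' fun s _ => (typein_lt_omega1 s.top).ne)
      (le_csInf ⟨Ordinal.omega 1, fun s _ => (typein_lt_omega1 s.top).ne⟩ fun δ hδ => ?_)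
    by_contra! hlt
    obtain ⟨α, hα⟩ := Ordinal.mem_range_typein_iff (α := Omega1) (· < ·) |>.2
      (hlt.trans_eq (Ordinal.type_toType _).symm)
    obtain ⟨s, hs, rfl⟩ := h α
    exact hδ s hs hα

theorem isSubtree_univ {T : Set 𝕊} (hT : IsCoherentTree T) (h : ∀ α, ∃ s ∈ T, s.top = α) :
    IsSubtree T univ := by
  refine ⟨subset_univ _, fun t ht s _ => hT.initial t ht s, ?_⟩
  rw [treeHeight_eq_omega1_iff.2 h, treeHeight_eq_omega1_iff.2]
  exact fun α => (h α).imp fun s hs => ⟨mem_univ s, hs.2⟩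

theorem not_countable_of_forall_exists_top {X : Set 𝕊} (h : ∀ α, ∃ s ∈ X, s.top = α) :
    ¬ X.Countable := fun hc =>
  not_countable_omega1 ((hc.image 𝕊.top).mono fun α _ => (h α).imp fun _ hs => hs)

/-! ## The construction -/

noncomputable instance : Inhabited 𝕊 :=
  ⟨⟨⊥, fun _ => 0, fun _ _ => rfl,
    fun _ => (finite_singleton ⊥).subset fun _ h => le_bot_iff.1 h.1⟩⟩

/-- Construction by transfinite recursion of a sequence each of whose terms satisfies a condition
on the preceding terms. -/
theorem exists_forall_of_recursion {P : (Omega1 → 𝕊) → Omega1 → 𝕊 → Prop}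
    (hcongr : ∀ e e' α s, (∀ β < α, e β = e' β) → P e α s → P e' α s)
    (hex : ∀ e α, (∀ β < α, P e β (e β)) → ∃ s, P e α s) : ∃ e, ∀ α, P e α (e α) := by
  classical
  -- Partial sequences are padded so that `P` applies to them; `hcongr` makes the padding harmless.
  let ext : ∀ α : Omega1, (∀ β, β < α → 𝕊) → Omega1 → 𝕊 := fun α ih β =>
    if h : β < α then ih β h else default
  let F : ∀ α : Omega1, (∀ β, β < α → 𝕊) → 𝕊 := fun α ih => Classical.epsilon (P (ext α ih) α)
  let e : Omega1 → 𝕊 := (wellFounded_lt (α := Omega1)).fix F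
  have he : ∀ α, e α = Classical.epsilon (P (ext α fun β _ => e β) α) := fun α =>
    WellFounded.fix_eq _ F α
  have hext : ∀ α, ∀ β < α, ext α (fun β _ => e β) β = e β := fun α β h => dif_pos h
  refine ⟨e, fun α => ?_⟩
  induction α using WellFoundedLT.induction with
  | ind α ih =>
    obtain ⟨s, hs⟩ := hex e α ih
    have := Classical.epsilon_spec (p := P (ext α fun β _ => e β) α)
      ⟨s, hcongr _ _ _ _ (fun β h => (hext α β h).symm) hs⟩
    rw [← he] at this
    exact hcongr _ _ _ _ (hext α) this

/-- The tree of modifications of `e α`, for `α ∈ I`. -/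
def treeOf (e : Omega1 → 𝕊) (I : Set Omega1) : Set 𝕊 :=
  {t | t.top ∈ I ∧ IsModification t (e t.top)}

theorem isCoherentTree_treeOf {e : Omega1 → 𝕊} {I : Set Omega1} (hI : IsLowerSet I)
    (he : ∀ γ ∈ I, ∀ β < γ, IsModification ((e γ).restrict β) (e β)) :
    IsCoherentTree (treeOf e I) := by
  have hres : ∀ t ∈ treeOf e I, ∀ β ≤ t.top, IsModification (t.restrict β) (e β) := by
    rintro t ⟨htI, ht⟩ β hβ
    rcases hβ.eq_or_lt with rfl | hβ
    · rwa [restrict_top_self]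
    · exact (ht.restrict β).trans (he _ htI β hβ)
  refine ⟨fun t ht s hs => ⟨hI hs.1 ht.1, ?_⟩, ?_, fun s hs t ht h => (hres t ht _ h).trans hs.2.symm⟩
  · have := hres t ht _ hs.1
    rwa [← hs.eq_restrict] at this
  · rintro s ⟨hsI, hs⟩ t hts
    rw [← hts.1] at hsI hs
    exact ⟨hsI, hts.trans hs⟩

theorem treeOf_congr {e e' : Omega1 → 𝕊} {I : Set Omega1} (h : ∀ α ∈ I, e α = e' α) :
    treeOf e I = treeOf e' I := by
  ext t
  refine and_congr_right fun ht => ?_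
  rw [h _ ht]

/-- An enumeration of the modifications of a sequence. -/
theorem exists_enum_isModification :
    ∃ f : 𝕊 → ℕ → 𝕊, ∀ s t, IsModification t s ↔ ∃ i, f s i = t := by
  have h := fun s => (countable_setOf_isModification s).exists_eq_range ⟨s, .refl s⟩
  choose f hf using h
  refine ⟨f, fun s t => ?_⟩
  rw [← mem_range, ← hf]
  rfl

/-- The subset of the tree of `e` below `α` which is coded by `W`. -/
def decode (f : 𝕊 → ℕ → 𝕊) (W : Set (Omega1 × ℕ)) (e : Omega1 → 𝕊) (α : Omega1) : Set 𝕊 :=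
  {t | t.top < α ∧ ∃ i, (t.top, i) ∈ W ∧ f (e t.top) i = t}

theorem decode_congr {f : 𝕊 → ℕ → 𝕊} {W : Set (Omega1 × ℕ)} {e e' : Omega1 → 𝕊} {α : Omega1}
    (h : ∀ β < α, e β = e' β) : decode f W e α = decode f W e' α := by
  ext t
  refine and_congr_right fun ht => ?_
  rw [h _ ht]

/-- A level of the tree is coherent with the preceding levels, and no node of it is a branch of
the set `V` if this set contains no frozen cone. -/
def IsLevel (V : (Omega1 → 𝕊) → Omega1 → Set 𝕊) (e : Omega1 → 𝕊) (α : Omega1) (s : 𝕊) : Prop :=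
  s.top = α ∧ (∀ β < α, IsModification (s.restrict β) (e β)) ∧
    (⊥ < α → (∀ s ∈ treeOf e (Iio α), ∀ n, ∃ u ∈ treeOf e (Iio α),
        (Initial u s ∨ NExtension n s u) ∧ u ∉ V e α) →
      ∀ t, IsModification t s → ∃ β < α, t.restrict β ∉ V e α)

theorem exists_isLevel (V : (Omega1 → 𝕊) → Omega1 → Set 𝕊)
    (hV : ∀ e e' α, (∀ β < α, e β = e' β) → V e α = V e' α) :
    ∃ e, ∀ α, IsLevel V e α (e α) := by
  refine exists_forall_of_recursion (P := IsLevel V) ?_ ?_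
  · rintro e e' α s h ⟨h₁, h₂, h₃⟩
    rw [treeOf_congr (I := Iio α) h, hV e e' α h] at h₃
    exact ⟨h₁, fun β hβ => h β hβ ▸ h₂ β hβ, h₃⟩
  · intro e α ih
    rcases (bot_le (a := α)).eq_or_lt with rfl | h₀
    · exact ⟨default, rfl, fun β h => absurd h not_lt_bot, fun h => absurd h (lt_irrefl _)⟩
    · have hS := isCoherentTree_treeOf (e := e) (isLowerSet_Iio α) fun γ hγ => (ih γ hγ).2.1
      have htop : ∀ s ∈ treeOf e (Iio α), s.top < α := fun s hs => hs.1
      have hex : ∀ β < α, ∃ s ∈ treeOf e (Iio α), s.top = β := fun β hβ =>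
        ⟨e β, ⟨(ih β hβ).1.trans_lt hβ, (ih β hβ).1.symm ▸ .refl _⟩, (ih β hβ).1⟩
      have hmod : ∀ s : 𝕊, s.top = α → (∀ β < α, s.restrict β ∈ treeOf e (Iio α)) →
          ∀ β < α, IsModification (s.restrict β) (e β) := fun s hs h β hβ => by
        have := (h β hβ).2
        rwa [restrict_top, hs, min_eq_left hβ.le] at this
      by_cases hc : ∀ s ∈ treeOf e (Iio α), ∀ n, ∃ u ∈ treeOf e (Iio α),
        (Initial u s ∨ NExtension n s u) ∧ u ∉ V e α
      · obtain ⟨s, hs, hres, h⟩ := hS.exists_top_eq h₀ htop hex hc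
        exact ⟨s, hs, hmod s hs hres, fun _ _ => h⟩
      -- When the avoidance clause is vacuous only coherence matters; the empty set trivially
      -- contains no cone.
      · obtain ⟨s, hs, hres, -⟩ := hS.exists_top_eq h₀ htop hex (V := ∅)
          fun s hs n => ⟨s, hs, Or.inl (.refl s), notMem_empty s⟩
        exact ⟨s, hs, hmod s hs hres, fun _ h => absurd h hc⟩

/-- Diamond gives a coherent tree each of whose subtrees contains a frozen cone. -/
theorem Diamond.exists_isCoherentTree (hd : Diamond) :
    ∃ T : Set 𝕊, IsCoherentTree T ∧ (∀ α, ∃ s ∈ T, s.top = α) ∧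
      ∀ U : Set 𝕊, IsSubtree U T → ∃ s ∈ T, ∃ n : ℕ, frozenCone T s n ⊆ U := by
  obtain ⟨W, hW⟩ := hd.exists_guess
  obtain ⟨f, hf⟩ := exists_enum_isModification
  obtain ⟨e, he⟩ := exists_isLevel (fun e α => decode f (W α) e α)
    fun _ _ _ h => decode_congr h
  have hT : IsCoherentTree (treeOf e univ) :=
    isCoherentTree_treeOf isLowerSet_univ fun γ _ => (he γ).2.1
  have hex : ∀ α, ∃ s ∈ treeOf e univ, s.top = α := fun α =>
    ⟨e α, ⟨mem_univ _, (he α).1.symm ▸ .refl _⟩, (he α).1⟩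
  refine ⟨treeOf e univ, hT, hex, fun U hU => ?_⟩
  obtain ⟨hUT, hUdown, hUheight⟩ := hU
  rw [treeHeight_eq_omega1_iff.2 hex, treeHeight_eq_omega1_iff] at hUheight
  by_contra! hcone
  have hout : ∀ s ∈ treeOf e univ, ∀ n, ∃ u ∈ treeOf e univ,
      (Initial u s ∨ NExtension n s u) ∧ u ∉ U := fun s hs n => by
    obtain ⟨u, ⟨h₁, h₂⟩, h₃⟩ := not_subset.1 (hcone s hs n)
    exact ⟨u, h₁, h₂, h₃⟩
  choose! w hwT hwc hwU using hout
  -- Levels are countable, so the witnesses `w s n` for nodes up to `ξ` are bounded. At a closure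
  -- point `α` of `g` they stay below `α`, and `U` below `α` contains no frozen cone either.
  have hbound : ∀ ξ, ∃ γ, ∀ s ∈ treeOf e univ, s.top ≤ ξ → ∀ n, (w s n).top < γ := fun ξ => by
    obtain ⟨γ, hγ⟩ := exists_forall_lt_of_countable
      (((hT.countable_top_le ξ).prod (countable_univ (α := ℕ))).image fun p => (w p.1 p.2).top)
    exact ⟨γ, fun s hs hξ n => hγ _ ⟨(s, n), ⟨⟨hs, hξ⟩, mem_univ n⟩, rfl⟩⟩
  choose g hg using hbound
  obtain ⟨α, h₀, hgα, hWα⟩ := hW {p | f (e p.1) p.2 ∈ U} g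
  have hdec : ∀ t, t ∈ decode f (W α) e α ↔ t.top < α ∧ t ∈ U := by
    intro t
    refine and_congr_right fun ht => ?_
    constructor
    · rintro ⟨i, h₁, h₂⟩
      have : f (e t.top) i ∈ U := (hWα t.top ht i).1 h₁
      rwa [h₂] at this
    · intro htU
      obtain ⟨i, hi⟩ := (hf _ _).1 (hUT htU).2
      refine ⟨i, (hWα t.top ht i).2 ?_, hi⟩
      rwa [mem_ofPred_eq, hi]
  -- `U` has a node at level `α`, all of whose restrictions lie in `U`; level `α` was built to
  -- forbid this.
  obtain ⟨t, htU, rfl⟩ := hUheight α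
  obtain ⟨β, hβ, hnot⟩ := (he t.top).2.2 h₀ (fun s hs n => by
    have hs' : s ∈ treeOf e univ := ⟨mem_univ _, hs.2⟩
    refine ⟨w s n, ⟨(hg s.top s hs' le_rfl n).trans (hgα _ hs.1), (hwT s hs' n).2⟩,
      hwc s hs' n, fun h => hwU s hs' n ((hdec _).1 h).2⟩) t (hUT htU).2
  refine hnot ((hdec _).2 ⟨(min_le_left _ _).trans_lt hβ, ?_⟩)
  exact hUdown t htU _ (hT.restrict_mem (hUT htU) β) (restrict_initial t β)

/-! ## The lexicographic order -/

namespace 𝕊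

variable {s s' t t' u : 𝕊}

/-- `s` branches off to the left of `t`. -/
def IsLeftOf (s t : 𝕊) : Prop :=
  ∃ ξ, ξ ≤ s.top ∧ ξ ≤ t.top ∧ (∀ η < ξ, s.val η = t.val η) ∧ s.val ξ < t.val ξ

theorem Initial.le (h : Initial s t) : s ≤ t := Or.inl h

theorem IsLeftOf.lt (h : IsLeftOf s t) : s < t := by
  refine lt_of_le_of_ne (Or.inr h) ?_
  rintro rfl
  obtain ⟨ξ, -, -, -, h⟩ := h
  exact h.false

theorem isLeftOf_of_lt (h : s < t) (h' : ¬ Initial s t) : IsLeftOf s t :=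
  (show LexLE s t from h.le).resolve_left h'

theorem isLeftOf_of_lt_of_top_eq (h : s < t) (h' : s.top = t.top) : IsLeftOf s t :=
  isLeftOf_of_lt h fun hi => h.ne (hi.eq_of_top_le h'.ge)

/-- Unlike the order itself, branching survives arbitrary extension of both nodes; this is why
embeddings are built from `IsLeftOf`. -/
theorem IsLeftOf.of_initial (h : IsLeftOf s t) (hs : Initial s s') (ht : Initial t t') :
    IsLeftOf s' t' := by
  obtain ⟨ξ, h₁, h₂, h₃, h₄⟩ := h
  refine ⟨ξ, h₁.trans hs.1, h₂.trans ht.1, fun η hη => ?_, ?_⟩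
  · rw [← hs.2 η (hη.le.trans h₁), ← ht.2 η (hη.le.trans h₂), h₃ η hη]
  · rwa [← hs.2 ξ h₁, ← ht.2 ξ h₂]

/-- The set of extensions of a node is convex. -/
theorem initial_of_lt_of_lt (hs : Initial u s) (ht : Initial u t) (h₁ : s < s') (h₂ : s' < t) :
    Initial u s' := by
  by_contra hu
  rcases lt_trichotomy s' u with h | rfl | h
  · by_cases hi : Initial s' u
    · exact ((hi.trans hs).le.trans_lt h₁).false
    · exact (h₁.trans ((isLeftOf_of_lt h hi).of_initial (.refl s') hs).lt).false
  · exact hu (.refl _)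
  · exact (h₂.trans ((isLeftOf_of_lt h hu).of_initial ht (.refl s')).lt).false

theorem exists_val_ne_of_not_initial (h : ¬ Initial s t) (h' : ¬ Initial t s) :
    ∃ ξ, ξ ≤ s.top ∧ ξ ≤ t.top ∧ (∀ η < ξ, s.val η = t.val η) ∧ s.val ξ ≠ t.val ξ := by
  rcases LexLE.total s t with hl | hl
  · obtain ⟨ξ, h₁, h₂, h₃, h₄⟩ := hl.resolve_left h
    exact ⟨ξ, h₁, h₂, h₃, h₄.ne⟩
  · obtain ⟨ξ, h₁, h₂, h₃, h₄⟩ := hl.resolve_left h'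
    exact ⟨ξ, h₂, h₁, fun η hη => (h₃ η hη).symm, h₄.ne'⟩

end 𝕊

/-! ## Countryman lines from coherence -/

/-- The difference of `t` and `s`, on the indices of `s`, is coded by `n` and `g`. -/
def HasDiffCode (n : ℕ) (g : List ℤ) (s t : 𝕊) : Prop :=
  s.top ≤ t.top ∧ ∀ ξ ≤ s.top, (t.val ξ : ℤ) - s.val ξ = g.getD (s.lowCount n ξ) 0

theorem IsCoherent.exists_hasDiffCode {S : Set 𝕊} (hS : IsCoherent S) {s t : 𝕊} (hs : s ∈ S)
    (ht : t ∈ S) (h : s.top ≤ t.top) : ∃ n g, HasDiffCode n g s t := by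
  have hm := hS s hs t ht h
  obtain ⟨n, g, hg⟩ := exists_eq_getD_lowCount (hm.1 ▸ hm.2)
  refine ⟨n, g, h, fun ξ hξ => ?_⟩
  rw [← hg ξ hξ, restrict_val hξ]

/-- With a common code the two differences agree up to and including the first index where `s` and
`s'` differ. So `t` and `t'` first differ there too, in the same direction. -/
theorem HasDiffCode.le_and_le_or {C : Set 𝕊} (hC : IsAntichain Initial C) {n : ℕ} {g : List ℤ}
    {s s' t t' : 𝕊} (hs : s ∈ C) (hs' : s' ∈ C) (ht : t ∈ C) (ht' : t' ∈ C)
    (h : HasDiffCode n g s t) (h' : HasDiffCode n g s' t') :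
    (s ≤ s' ∧ t ≤ t') ∨ (s' ≤ s ∧ t' ≤ t) := by
  rcases eq_or_ne s s' with rfl | hss
  · simpa using le_total t t'
  rcases eq_or_ne t t' with rfl | htt
  · simpa using le_total s s'
  have key : ∀ ξ, ξ ≤ s.top → ξ ≤ s'.top → (∀ η < ξ, s.val η = s'.val η) →
      (t.val ξ : ℤ) - s.val ξ = t'.val ξ - s'.val ξ := fun ξ h₁ h₂ h₃ => by
    rw [h.2 ξ h₁, h'.2 ξ h₂, lowCount_congr h₁ h₂ h₃]
  obtain ⟨ξ, h₁, h₂, h₃, h₄⟩ := exists_val_ne_of_not_initial (hC hs hs' hss) (hC hs' hs hss.symm)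
  obtain ⟨ζ, k₁, k₂, k₃, k₄⟩ := exists_val_ne_of_not_initial (hC ht ht' htt) (hC ht' ht htt.symm)
  have hξζ : ξ = ζ := by
    rcases lt_trichotomy ξ ζ with hlt | heq | hlt
    · have := key ξ h₁ h₂ h₃
      have := k₃ ξ hlt
      omega
    · exact heq
    · have := key ζ (hlt.le.trans h₁) (hlt.le.trans h₂) fun η hη => h₃ η (hη.trans hlt)
      have := h₃ ζ hlt
      omega
  subst hξζ
  have hk := key ξ h₁ h₂ h₃
  rcases lt_or_gt_of_ne h₄ with hlt | hlt
  · exact Or.inl ⟨IsLeftOf.lt ⟨ξ, h₁, h₂, h₃, hlt⟩ |>.le,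
      IsLeftOf.lt ⟨ξ, k₁, k₂, k₃, by omega⟩ |>.le⟩
  · exact Or.inr ⟨IsLeftOf.lt ⟨ξ, h₂, h₁, fun η hη => (h₃ η hη).symm, hlt⟩ |>.le,
      IsLeftOf.lt ⟨ξ, k₂, k₁, fun η hη => (k₃ η hη).symm, by omega⟩ |>.le⟩

theorem IsCoherentTree.mk_le {T : Set 𝕊} (hT : IsCoherentTree T) :
    Cardinal.mk T ≤ Cardinal.aleph 1 := by
  have h := fun α => (hT.countable_level α).to_subtype.exists_injective_nat
  choose f hf using h
  have hinj : Function.Injective fun t : T => (t.1.top, f t.1.top ⟨t.1, t.2, rfl⟩) := by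
    rintro ⟨s, hs⟩ ⟨t, ht⟩ hst
    obtain ⟨h₁, h₂⟩ := Prod.ext_iff.1 hst
    dsimp only at h₁ h₂
    have : ∀ (α β : Omega1) (a : {t ∈ T | t.top = α}) (b : {t ∈ T | t.top = β}), α = β →
        f α a = f β b → a.1 = b.1 := by
      rintro α _ a b rfl hab
      rw [hf α hab]
    exact Subtype.ext (this _ _ _ _ h₁ h₂)
  have := Cardinal.mk_le_of_injective hinj
  simpa [Cardinal.mk_prod, mk_omega1] using this

theorem IsCoherentTree.isCountrymanLine {T : Set 𝕊} (hT : IsCoherentTree T) {C : Set 𝕊}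
    (hCT : C ⊆ T) (hC : IsAntichain Initial C) (hCc : ¬ C.Countable) : IsCountrymanLine C := by
  refine ⟨le_antisymm ((Cardinal.mk_le_mk_of_subset hCT).trans hT.mk_le) ?_, ?_⟩
  · rwa [← not_lt, Cardinal.lt_aleph_one_iff, Cardinal.le_aleph0_iff_set_countable]
  -- The Boolean records which coordinate is the shorter one.
  obtain ⟨f, hf⟩ := exists_surjective_nat (Bool × ℕ × List ℤ)
  let F : Bool × ℕ × List ℤ → Set (C × C) := fun c =>
    {p | (c.1 = true → HasDiffCode c.2.1 c.2.2 p.1 p.2) ∧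
      (c.1 = false → HasDiffCode c.2.1 c.2.2 p.2 p.1)}
  have hF : ∀ c, IsChain (· ≤ ·) (F c) := by
    rintro ⟨b, k, g⟩ ⟨s, t⟩ h ⟨s', t'⟩ h' -
    cases b with
    | true => exact HasDiffCode.le_and_le_or hC s.2 s'.2 t.2 t'.2 (h.1 rfl) (h'.1 rfl)
    | false =>
      exact (HasDiffCode.le_and_le_or hC t.2 t'.2 s.2 s'.2 (h.2 rfl) (h'.2 rfl)).imp
        And.symm And.symm
  refine ⟨fun n => F (f n), fun n => hF (f n), eq_univ_of_forall fun p => ?_⟩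
  obtain ⟨⟨s, hs⟩, ⟨t, ht⟩⟩ := p
  rcases le_total s.top t.top with h | h
  · obtain ⟨k, g, hkg⟩ := hT.coherent.exists_hasDiffCode (hCT hs) (hCT ht) h
    obtain ⟨n, hn⟩ := hf (true, k, g)
    exact mem_iUnion.2 ⟨n, by rw [hn]; exact ⟨fun _ => hkg, fun h => by simp at h⟩⟩
  · obtain ⟨k, g, hkg⟩ := hT.coherent.exists_hasDiffCode (hCT ht) (hCT hs) h
    obtain ⟨n, hn⟩ := hf (false, k, g)
    exact mem_iUnion.2 ⟨n, by rw [hn]; exact ⟨fun h => by simp at h, fun _ => hkg⟩⟩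

/-! ## Uncountable antichains -/

/-- Fix the last value `n` and the number of indices with value at most `n`. A proper extension with
the same `n` has one more such index, its own top, so it has a larger count. -/
theorem exists_uncountable_isAntichain {X : Set 𝕊} (hX : ¬ X.Countable) :
    ∃ C ⊆ X, ¬ C.Countable ∧ IsAntichain Initial C := by
  have h : ∃ n k, ¬ {t ∈ X | t.val t.top = n ∧ (t.low n).card = k}.Countable := by
    by_contra! h
    refine hX ((countable_iUnion fun n => countable_iUnion fun k => h n k).mono fun t ht => ?_)
    exact mem_iUnion.2 ⟨_, mem_iUnion.2 ⟨_, ht, rfl, rfl⟩⟩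
  obtain ⟨n, k, hnk⟩ := h
  refine ⟨_, fun t ht => ht.1, hnk, ?_⟩
  rintro s ⟨-, hs, hsk⟩ t ⟨-, ht, htk⟩ hne hi
  have hlt : s.top < t.top := by
    by_contra! h
    exact hne (hi.eq_of_top_le h)
  have hss : s.low n ⊂ t.low n := by
    rw [Finset.ssubset_iff_of_subset fun ξ hξ => ?_]
    · exact ⟨t.top, mem_low.2 ⟨le_rfl, ht.le⟩, fun h => (mem_low.1 h).1.not_gt hlt⟩
    · rw [mem_low] at hξ ⊢
      exact ⟨hξ.1.trans hi.1, hi.2 ξ hξ.1 ▸ hξ.2⟩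
  exact (Finset.card_lt_card hss).ne (hsk.trans htk.symm)

/-! ## Dense sets of nodes -/

namespace IsCoherentTree

variable {T : Set 𝕊} {s t u : 𝕊}

/-- Successor indices are isolated, so raising a single value there is a modification. It is
realised by two splices, with shift `1` on that index and shift `0` after it. -/
theorem exists_val_succ_eq (hT : IsCoherentTree T) (hu : u ∈ T) {ξ : Omega1} (hξ : ξ < u.top) :
    ∃ v ∈ T, v.top = u.top ∧ (∀ η ≤ ξ, v.val η = u.val η) ∧
      v.val (Order.succ ξ) = u.val (Order.succ ξ) + 1 ∧
      ∀ η, Order.succ ξ < η → η ≤ u.top → v.val η = u.val η := by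
  have hs : Order.succ ξ ≤ u.top := Order.succ_le_of_lt hξ
  have h₁ : (u.restrict ξ).top = ξ := min_eq_left hξ.le
  have h₂ : (u.restrict (Order.succ ξ)).top = Order.succ ξ := min_eq_left hs
  have h₁₂ : (u.restrict ξ).top ≤ (u.restrict (Order.succ ξ)).top := by
    rw [h₁, h₂]
    exact Order.le_succ ξ
  set w := splice (u.restrict ξ) (u.restrict (Order.succ ξ)) 1 with hw
  have hwT : w ∈ T := hT.splice_mem (hT.restrict_mem hu _) (hT.restrict_mem hu _) h₁₂
    fun _ _ _ => by positivity
  have hwtop : w.top = Order.succ ξ := (splice_top h₁₂).trans h₂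
  have hwu : w.top ≤ u.top := hwtop.trans_le hs
  refine ⟨splice w u 0, hT.splice_mem hwT hu hwu fun _ _ _ => by positivity, splice_top hwu,
    fun η hη => ?_, ?_, fun η h h' => ?_⟩
  · rw [splice_val (hwtop ▸ hη.trans (Order.le_succ ξ)), hw, splice_val (hη.trans h₁.ge),
      restrict_val hη]
  · rw [splice_val hwtop.ge, hw, splice_val_of_gt (h₁.trans_lt (Order.lt_succ ξ)) h₂.ge,
      restrict_val le_rfl]
    omega
  · rw [splice_val_of_gt (hwtop.trans_lt h) h']
    omega

/-- If `u` branches left of `v` at `ξ`, raising `u` at the successor of `ξ` gives a node strictly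
between them. This needs room above `ξ`, so `δ` is closed under successors. -/
theorem exists_dense (hT : IsCoherentTree T) (hex : ∀ α, ∃ s ∈ T, s.top = α) (hs : s ∈ T)
    (n : ℕ) : ∃ (δ : Omega1) (Q : Set 𝕊), (∀ u ∈ Q, u ∈ T ∧ u.top = δ ∧ NExtension n s u) ∧
      DenselyOrdered Q ∧ Nontrivial Q := by
  obtain ⟨δ, hδ, hsucc⟩ := exists_gt_forall_lt_imp_lt Order.succ s.top
  obtain ⟨u₁, hu₁, hu₁δ⟩ := hex δ
  obtain ⟨u₀, hu₀, hu₀δ, hsu₀⟩ := hT.exists_nExtension hs hu₁ (hδ.le.trans hu₁δ.ge) n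
  rw [hu₁δ] at hu₀δ
  -- Fixing the value at `δ` forces branching to happen strictly below `δ`.
  let Q : Set 𝕊 := {u | u ∈ T ∧ u.top = δ ∧ NExtension n s u ∧ u.val δ = u₀.val δ}
  have hQ : ∀ u ∈ Q, ∀ ξ, s.top ≤ ξ → ξ < δ → ∃ v ∈ Q, (∀ η ≤ ξ, v.val η = u.val η) ∧
      v.val (Order.succ ξ) = u.val (Order.succ ξ) + 1 := by
    rintro u ⟨huT, huδ, hsu, huc⟩ ξ hsξ hξ
    obtain ⟨v, hv, hvt, h₁, h₂, h₃⟩ := hT.exists_val_succ_eq huT (hξ.trans_eq huδ.symm)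
    rw [huδ] at hvt h₃
    refine ⟨v, ⟨hv, hvt, ⟨⟨hδ.le.trans hvt.ge, fun η hη => ?_⟩, fun η h h' => ?_⟩, ?_⟩, h₁, h₂⟩
    · rw [h₁ η (hη.trans hsξ), hsu.1.2 η hη]
    · rw [hvt] at h'
      have hη := hsu.2 η h (h'.trans huδ.ge)
      rcases lt_trichotomy η (Order.succ ξ) with hlt | rfl | hlt
      · rwa [h₁ η (Order.le_of_lt_succ hlt)]
      · omega
      · rwa [h₃ η hlt h']
    · rw [h₃ δ (hsucc ξ hξ) le_rfl, huc]
  refine ⟨δ, Q, fun u hu => ⟨hu.1, hu.2.1, hu.2.2.1⟩, ⟨?_⟩, ?_⟩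
  · rintro ⟨u, hu⟩ ⟨v, hv⟩ huv
    obtain ⟨ξ, h₁, h₂, h₃, h₄⟩ := isLeftOf_of_lt_of_top_eq (Subtype.mk_lt_mk.1 huv)
      (hu.2.1.trans hv.2.1.symm)
    have hξ : ξ < δ := by
      refine lt_of_le_of_ne (h₁.trans hu.2.1.le) ?_
      rintro rfl
      rw [hu.2.2.2, hv.2.2.2] at h₄
      exact h₄.false
    have hsξ : s.top ≤ ξ := by
      by_contra! h
      rw [← hu.2.2.1.1.2 ξ h.le, ← hv.2.2.1.1.2 ξ h.le] at h₄
      exact h₄.false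
    obtain ⟨w, hw, hw₁, hw₂⟩ := hQ u hu ξ hsξ hξ
    have hξs := (hsucc ξ hξ).le
    refine ⟨⟨w, hw⟩, Subtype.mk_lt_mk.2 (IsLeftOf.lt ⟨Order.succ ξ, hξs.trans hu.2.1.ge,
      hξs.trans hw.2.1.ge, fun η hη => (hw₁ η (Order.le_of_lt_succ hη)).symm, by omega⟩),
      Subtype.mk_lt_mk.2 (IsLeftOf.lt ⟨ξ, hξ.le.trans hw.2.1.ge, h₂,
        fun η hη => (hw₁ η hη.le).trans (h₃ η hη), by rwa [hw₁ ξ le_rfl]⟩)⟩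
  · have hu₀Q : u₀ ∈ Q := ⟨hu₀, hu₀δ, hsu₀, rfl⟩
    obtain ⟨v, hv, -, h⟩ := hQ u₀ hu₀Q s.top le_rfl hδ
    refine ⟨⟨u₀, hu₀Q⟩, ⟨v, hv⟩, fun heq => ?_⟩
    rw [← Subtype.mk.inj heq] at h
    omega

/-- Every countable linear order embeds into the set of the `n`-extensions of a node of a given
height. -/
theorem exists_forall_isLeftOf (hT : IsCoherentTree T) (hex : ∀ α, ∃ s ∈ T, s.top = α)
    (hs : s ∈ T) (n : ℕ) : ∃ δ : Omega1, ∀ (L : Type) [LinearOrder L] [Countable L],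
      ∃ r : L → 𝕊, (∀ x, r x ∈ T ∧ (r x).top = δ ∧ NExtension n s (r x)) ∧
        ∀ x y, x < y → IsLeftOf (r x) (r y) := by
  obtain ⟨δ, Q, hQ, _, _⟩ := hT.exists_dense hex hs n
  refine ⟨δ, fun L _ _ => ?_⟩
  obtain ⟨r⟩ := Order.embedding_from_countable_to_dense L Q
  exact ⟨fun x => r x, fun x => hQ _ (r x).2, fun x y h => isLeftOf_of_lt_of_top_eq
    (r.lt_iff_lt.2 h) ((hQ _ (r x).2).2.1.trans (hQ _ (r y).2).2.1.symm)⟩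

end IsCoherentTree

/-! ## Coherent trees with frozen cones -/

/-- A coherent tree of height `ω₁` such that the downward closure of each of its uncountable
subsets contains a frozen cone. -/
structure HasFrozenCones (T : Set 𝕊) : Prop extends IsCoherentTree T where
  exists_top : ∀ α, ∃ s ∈ T, s.top = α
  exists_cone : ∀ X ⊆ T, ¬ X.Countable →
    ∃ s ∈ T, ∃ n, ∀ t ∈ T, NExtension n s t → ∃ x ∈ X, Initial t x

theorem hasFrozenCones_of_isSubtree {T : Set 𝕊} (hT : IsCoherentTree T)
    (hex : ∀ α, ∃ s ∈ T, s.top = α)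
    (h : ∀ U : Set 𝕊, IsSubtree U T → ∃ s ∈ T, ∃ n : ℕ, frozenCone T s n ⊆ U) :
    HasFrozenCones T := by
  refine ⟨hT, hex, fun X hXT hX => ?_⟩
  obtain ⟨s, hs, n, hsub⟩ := h {t | t ∈ T ∧ ∃ x ∈ X, Initial t x}
    ⟨fun t ht => ht.1, fun t ⟨_, x, hx, htx⟩ s hs hst => ⟨hs, x, hx, hst.trans htx⟩, by
      rw [treeHeight_eq_omega1_iff.2 hex, treeHeight_eq_omega1_iff]
      intro α
      obtain ⟨x, hx, hαx⟩ : ∃ x ∈ X, α ≤ x.top := by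
        by_contra! hc
        refine hX ((hT.countable_top_lt α).mono ?_)
        exact fun x hx => ⟨hXT hx, hc x hx⟩
      exact ⟨x.restrict α, ⟨hT.restrict_mem (hXT hx) α, x, hx, restrict_initial x α⟩,
        min_eq_left hαx⟩⟩
  exact ⟨s, hs, n, fun t ht hst => (hsub ⟨ht, Or.inr hst⟩).2⟩

namespace HasFrozenCones

variable {T : Set 𝕊}

/-- The part of `c` up to `δ` is replaced by its image under `r` in the cone, and the rest is
shifted by `n` to remain in the cone. The result then extends to a member of `X`. -/
theorem exists_strictMono (hT : HasFrozenCones T) {C X : Set 𝕊} (hCT : C ⊆ T)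
    (hC : IsAntichain Initial C) (hXT : X ⊆ T) (hX : ¬ X.Countable) :
    ∃ f : C → 𝕊, StrictMono f ∧ ∀ c, f c ∈ X := by
  obtain ⟨s, hs, n, hcone⟩ := hT.exists_cone X hXT hX
  obtain ⟨δ, hδ⟩ := hT.exists_forall_isLeftOf hT.exists_top hs n
  have hN : Countable {t ∈ T | t.top ≤ δ} := (hT.countable_top_le δ).to_subtype
  -- Here it matters that `δ` was obtained before the countable order, which itself depends on `δ`.
  obtain ⟨r, hr, hrlt⟩ := hδ {t ∈ T | t.top ≤ δ}
  let p : C → {t ∈ T | t.top ≤ δ} := fun c =>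
    ⟨c.1.restrict δ, hT.restrict_mem (hCT c.2) δ, min_le_left _ _⟩
  let q : C → 𝕊 := fun c => splice (r (p c)) c n
  have hqr : ∀ c, Initial (r (p c)) (q c) := fun c => initial_splice
  have hqs : ∀ c, NExtension n s (q c) := fun c => by
    refine (hr (p c)).2.2.trans ⟨hqr c, fun ξ h₁ h₂ => ?_⟩
    have h₃ : ξ ≤ c.1.top := (le_max_iff.1 h₂).resolve_left h₁.not_ge
    simp only [q]
    rw [splice_val_of_gt h₁ h₃]
    omega
  have hqT : ∀ c, q c ∈ T := fun c => by
    rcases le_total (r (p c)).top c.1.top with h | h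
    · exact hT.splice_mem (hr (p c)).1 (hCT c.2) h fun _ _ _ => by positivity
    · rw [← (hqr c).eq_of_top_le (max_le le_rfl h)]
      exact (hr (p c)).1
  have hq : ∀ c d, c < d → IsLeftOf (q c) (q d) := by
    intro c d hcd
    obtain ⟨ξ, h₁, h₂, h₃, h₄⟩ := isLeftOf_of_lt (Subtype.coe_lt_coe.2 hcd)
      (hC c.2 d.2 (Subtype.coe_injective.ne hcd.ne))
    -- Branching up to `δ` is carried by `r`; later branching by the equal shifts over a common
    -- lower part.
    rcases le_or_gt ξ δ with h | h
    · refine (hrlt _ _ (Subtype.mk_lt_mk.2 (IsLeftOf.lt ⟨ξ, le_min h h₁, le_min h h₂,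
        fun η hη => ?_, ?_⟩))).of_initial (hqr c) (hqr d)
      · rw [restrict_val (hη.le.trans h), restrict_val (hη.le.trans h), h₃ η hη]
      · rwa [restrict_val h, restrict_val h]
    · have hpq : p c = p d := by
        refine Subtype.ext (ext_of_le ?_ fun η hη => ?_)
        · simp only [p, restrict_top]
          rw [min_eq_left (h.le.trans h₁), min_eq_left (h.le.trans h₂)]
        · have hη' : η ≤ δ := hη.trans (min_le_left _ _)
          simp only [p]
          rw [restrict_val hη', restrict_val hη', h₃ η (hη'.trans_lt h)]
      have hc := (hr (p c)).2.1
      have hd := (hr (p d)).2.1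
      refine ⟨ξ, le_max_of_le_right h₁, le_max_of_le_right h₂, fun η hη => ?_, ?_⟩
      · rcases le_or_gt η δ with h' | h'
        · rw [← (hqr c).2 η (h'.trans hc.ge), ← (hqr d).2 η (h'.trans hd.ge), hpq]
        · simp only [q]
          rw [splice_val_of_gt (hc.trans_lt h') (hη.le.trans h₁),
            splice_val_of_gt (hd.trans_lt h') (hη.le.trans h₂), h₃ η hη]
      · simp only [q]
        rw [splice_val_of_gt (hc.trans_lt h) h₁, splice_val_of_gt (hd.trans_lt h) h₂]
        omega
  have hx := fun c => hcone (q c) (hqT c) (hqs c)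
  choose f hfX hf using hx
  exact ⟨f, fun c d h => ((hq c d h).of_initial (hf c) (hf d)).lt, hfX⟩

/-! ## Uncountable suborders -/

section Suborder

variable {L : Type} [LinearOrder L] (j : L ↪o 𝕊)

/-- Every countable linear order embeds above each node of some frozen cone. -/
theorem exists_orderEmbedding_initial (hT : HasFrozenCones T) (hjT : ∀ x, j x ∈ T)
    (hL : Uncountable L) : ∃ s ∈ T, ∃ n, ∀ u ∈ T, NExtension n s u →
      ∀ (K : Type) [LinearOrder K] [Countable K], ∃ f : K ↪o L, ∀ x, Initial u (j (f x)) := by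
  have hX : ¬ (range j).Countable := fun h => not_countable_univ (α := L)
    (countable_of_injective_of_countable_image (j.injective.injOn) (image_univ ▸ h))
  obtain ⟨s, hs, n, hcone⟩ := hT.exists_cone (range j) (range_subset_iff.2 hjT) hX
  refine ⟨s, hs, n, fun u hu hsu K _ _ => ?_⟩
  obtain ⟨δ, hδ⟩ := hT.exists_forall_isLeftOf hT.exists_top hu n
  obtain ⟨r, hr, hrlt⟩ := hδ K
  have hx : ∀ x, ∃ y, Initial (r x) (j y) := fun x => by
    obtain ⟨_, ⟨y, rfl⟩, hy⟩ := hcone (r x) (hr x).1 (hsu.trans (hr x).2.2)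
    exact ⟨y, hy⟩
  choose f hf using hx
  exact ⟨OrderEmbedding.ofStrictMono f fun x y h =>
    j.lt_iff_lt.1 ((hrlt x y h).of_initial (hf x) (hf y)).lt,
    fun x => (hr x).2.2.1.trans (hf x)⟩

theorem not_isScattered (hT : HasFrozenCones T) (hjT : ∀ x, j x ∈ T) (hL : Uncountable L) :
    ¬ IsScattered L := by
  obtain ⟨s, hs, n, h⟩ := hT.exists_orderEmbedding_initial j hjT hL
  obtain ⟨f, -⟩ := h s hs (.refl n s) ℚ
  exact fun h => h.false f

/-- There are nonempty intervals of extensions of each node of some frozen cone. -/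
theorem exists_interval (hT : HasFrozenCones T) (hjT : ∀ x, j x ∈ T) (hL : Uncountable L) :
    ∃ s ∈ T, ∃ n, ∀ u ∈ T, NExtension n s u →
      ∃ a b : L, (Ioo a b).Nonempty ∧ ∀ x ∈ Ioo a b, Initial u (j x) := by
  obtain ⟨s, hs, n, h⟩ := hT.exists_orderEmbedding_initial j hjT hL
  refine ⟨s, hs, n, fun u hu hsu => ?_⟩
  obtain ⟨f, hf⟩ := h u hu hsu ℚ
  exact ⟨f 0, f 2, ⟨f 1, f.lt_iff_lt.2 (by norm_num), f.lt_iff_lt.2 (by norm_num)⟩,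
    fun x hx => initial_of_lt_of_lt (hf 0) (hf 2) (j.lt_iff_lt.2 hx.1) (j.lt_iff_lt.2 hx.2)⟩

/-- The nodes of a countable set have bounded height, but some nonempty interval consists of
extensions of a node above that bound. -/
theorem not_isSeparableLine (hT : HasFrozenCones T) (hjT : ∀ x, j x ∈ T) (hL : Uncountable L) :
    ¬ IsSeparableLine L := by
  intro hsep
  let _ : TopologicalSpace L := Preorder.topology L
  have : OrderTopology L := ⟨rfl⟩
  obtain ⟨D, hDc, hD⟩ := hsep.exists_countable_dense
  obtain ⟨s, hs, n, h⟩ := hT.exists_interval j hjT hL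
  obtain ⟨δ, hδ⟩ := exists_forall_lt_of_countable (hDc.image fun x => (j x).top)
  obtain ⟨t, ht, htδ⟩ := hT.exists_top (max s.top δ)
  obtain ⟨u, hu, hut, hsu⟩ := hT.exists_nExtension hs ht ((le_max_left _ _).trans htδ.ge) n
  obtain ⟨a, b, hne, hab⟩ := h u hu hsu
  obtain ⟨x, hx, hxD⟩ := hD.inter_open_nonempty _ isOpen_Ioo hne
  have h₁ := (hab x hx).1
  rw [hut, htδ] at h₁
  exact ((le_max_right _ _).trans h₁).not_gt (hδ _ ⟨x, hxD, rfl⟩)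

/-- Intervals above incomparable nodes are disjoint, and the cone contains an uncountable antichain.
-/
theorem not_isSouslinLine (hT : HasFrozenCones T) (hjT : ∀ x, j x ∈ T) (hL : Uncountable L) :
    ¬ IsSouslinLine L := by
  rintro ⟨-, hccc⟩
  obtain ⟨s, hs, n, h⟩ := hT.exists_interval j hjT hL
  have hcone : ¬ {u | u ∈ T ∧ NExtension n s u}.Countable := fun hc => by
    obtain ⟨δ, hδ⟩ := exists_forall_lt_of_countable (hc.image 𝕊.top)
    obtain ⟨t, ht, htδ⟩ := hT.exists_top (max s.top δ)
    obtain ⟨u, hu, hut, hsu⟩ := hT.exists_nExtension hs ht ((le_max_left _ _).trans htδ.ge) n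
    exact (hδ u.top ⟨u, ⟨hu, hsu⟩, rfl⟩).not_ge
      ((le_max_right _ _).trans (hut.trans htδ).ge)
  obtain ⟨A, hA, hAc, hanti⟩ := exists_uncountable_isAntichain hcone
  choose! a b hne hab using h
  have hdisj : ∀ u ∈ A, ∀ v ∈ A, ∀ x, x ∈ Ioo (a u) (b u) → x ∈ Ioo (a v) (b v) → u = v := by
    intro u hu v hv x hxu hxv
    by_contra huv
    rcases (hab u (hA hu).1 (hA hu).2 x hxu).total (hab v (hA hv).1 (hA hv).2 x hxv) with h | h
    · exact hanti hu hv huv h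
    · exact hanti hv hu (Ne.symm huv) h
  refine hAc (countable_of_injective_of_countable_image (f := fun u => Ioo (a u) (b u)) ?_
    (hccc _ ?_ ?_))
  · intro u hu v hv huv
    obtain ⟨x, hx⟩ := hne u (hA hu).1 (hA hu).2
    exact hdisj u hu v hv x hx ((show Ioo (a u) (b u) = Ioo (a v) (b v) from huv) ▸ hx)
  · rintro _ ⟨u, hu, rfl⟩
    exact ⟨hne u (hA hu).1 (hA hu).2, a u, b u, rfl⟩
  · rintro _ ⟨u, hu, rfl⟩ _ ⟨v, hv, rfl⟩ huv
    refine disjoint_left.2 fun x hxu hxv => huv ?_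
    rw [hdisj u hu v hv x hxu hxv]

end Suborder

theorem nonempty_orderEmbedding (hT : HasFrozenCones T) {C : Set 𝕊} (hCT : C ⊆ T)
    (hC : IsAntichain Initial C) (X : Set C) (hX : ¬ X.Countable) : Nonempty (C ↪o X) := by
  obtain ⟨f, hf, hfX⟩ := hT.exists_strictMono hCT hC (X := Subtype.val '' X)
    (by rintro _ ⟨x, -, rfl⟩; exact hCT x.2)
    (fun h => hX (countable_of_injective_of_countable_image Subtype.val_injective.injOn h))
  choose g hgX hg using hfX
  exact ⟨OrderEmbedding.ofStrictMono (fun c => (⟨g c, hgX c⟩ : X)) fun c d h =>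
    Subtype.mk_lt_mk.2 (Subtype.coe_lt_coe.1 (by rw [hg, hg]; exact hf h))⟩

theorem isAronszajnLine (hT : HasFrozenCones T) {C : Set 𝕊} (hCT : C ⊆ T)
    (hCc : ¬ C.Countable) : IsAronszajnLine C := by
  refine ⟨not_countable_iff.1 hCc, fun X hX => ?_⟩
  have hj : ∀ x, ((OrderEmbedding.subtype (· ∈ X)).trans (OrderEmbedding.subtype (· ∈ C))) x ∈ T :=
    fun x => hCT x.1.2
  exact ⟨hT.not_isSeparableLine _ hj (not_countable_iff.1 hX),
    hT.not_isScattered _ hj (not_countable_iff.1 hX)⟩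

end HasFrozenCones

theorem IsCountrymanLine.not_countable {L : Type*} [LinearOrder L] {X : Set L}
    (h : IsCountrymanLine X) : ¬ X.Countable := by
  rw [← Cardinal.le_aleph0_iff_set_countable, h.1, not_le]
  exact Cardinal.aleph0_lt_aleph_one

end MinimalCountryman

theorem theorem1p12 (hdiamond : Diamond) :
    ∃ T : Set 𝕊, IsSubtree T Set.univ ∧ IsCoherent T ∧ IsFull T ∧
      (∀ U : Set 𝕊, IsSubtree U T → ∃ s ∈ T, ∃ n : ℕ, frozenCone T s n ⊆ U) ∧
      ∃ C : Set 𝕊, C ⊆ T ∧ ¬ C.Countable ∧ IsAntichain 𝕊.Initial C ∧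
        IsCountrymanLine C ∧
        (∀ X : Set C, ¬ X.Countable → Nonempty (C ↪o X)) ∧
        IsMinimalIn IsCountrymanLine C ∧
        IsMinimalIn IsAronszajnLine C ∧
        ¬ IsSouslinLine C := by
  obtain ⟨T, hT, hex, hcone⟩ := hdiamond.exists_isCoherentTree
  have hfc := hasFrozenCones_of_isSubtree hT hex hcone
  have hTc := not_countable_of_forall_exists_top hex
  obtain ⟨C, hCT, hCc, hC⟩ := exists_uncountable_isAntichain hTc
  have hemb := hfc.nonempty_orderEmbedding hCT hC
  have hcm := hT.isCountrymanLine hCT hC hCc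
  exact ⟨T, isSubtree_univ hT hex, hT.coherent, ⟨hTc, hT.initial, hT.modification⟩, hcone,
    C, hCT, hCc, hC, hcm, hemb, ⟨hcm, fun X hX => hemb X hX.not_countable⟩,
    ⟨hfc.isAronszajnLine hCT hCc, fun X hX => hemb X (not_countable_iff.2 hX.1)⟩,
    hfc.not_isSouslinLine (OrderEmbedding.subtype (· ∈ C)) (fun x => hCT x.2)
      (not_countable_iff.1 hCc)⟩
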